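/- Let $\gamma$ be an oval, that is, a $C^\infty$-smooth simple closed convex curve in the Euclidean plane with everywhere positive curvature, oriented counterclockwise, and let $K$ be the closed convex region that it bounds. *The map $F$.* For a point $A\notin K$ let $Ax'$ and $Ax$ be the positive and the negative tangent segments from $A$ to $\gamma$, with $x,x'\in\gamma$: the orientation of $\gamma$ at $x'$ is that of the vector $\overrightarrow{Ax'}$, and at $x$ it is that of $\overrightarrow{xA}$. Consider the circle that is tangent to $\gamma$ at $x'$, lies on the right of the ray $Ax'$, and is tangent to the line $Ax$. The outer length billiard map $F$ sends $A$ to the intersection point of the line $Ax'$ with the third common tangent line of this circle and $\gamma$ (the one different from $Ax$ and $Ax'$). *The flow $\Phi_O$.* For a direction $\alpha$ let $w(\alpha)$ be the distance between the two support lines of $\gamma$ parallel to $(\cos\alpha,\sin\alpha)$. For a point $O$ let $(\alpha,r)$ be the polar coordinates with origin $O$, and let $\Phi_O$ be the time-1 flow of the vector field $X=-\frac{2w(\alpha)}{r}\,\partial_\alpha$ on the plane without $O$. **Theorem.** $F$ is a well-defined map of the exterior $\mathbb{R}^2\setminus K$ to itself, $\Phi_O$ is well defined on $\mathbb{R}^2\setminus\{O\}$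 for every point $O$, and there is a constant $C$, depending only on $\gamma$, such that for every origin $O$ in the interior of $K$ and every $x\notin K$ $$|F^2(x)-\Phi_O(x)|\le \frac{C}{|x-O|}.$$ -/

import Mathlib

namespace OuterLength

/-- The oriented area (determinant) of two vectors of the Euclidean plane `ℂ = ℝ²`.
It is positive when `v` points to the left of `u`. -/
def cross (u v : ℂ) : ℝ := u.re * v.im - u.im * v.re

/-- `γ` is a `T`-periodic counterclockwise parametrization of an oval: a smooth simple closed convex
plane curve with everywhere positive curvature. Convexity says that the curve lies on the left of each
of its tangent lines. Positivity of `cross γ' γ''` is positivity of the curvature, and it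
contains regularity `γ' ≠ 0`. -/
structure IsOval (γ : ℝ → ℂ) (T : ℝ) : Prop where
  period_pos : 0 < T
  smooth : ContDiff ℝ (⊤ : ℕ∞) γ
  periodic : Function.Periodic γ T
  simple : Set.InjOn γ (Set.Ico 0 T)
  curvature_pos : ∀ t, 0 < cross (deriv γ t) (deriv (deriv γ) t)
  convex : ∀ s t, 0 ≤ cross (deriv γ t) (γ s - γ t)

/-- The closed region bounded by a convex curve `γ` (the billiard table). -/
def table (γ : ℝ → ℂ) : Set ℂ := convexHull ℝ (Set.range γ)

/-- The line through `p` in the direction `v` is tangent to the circle with center `c` and radius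
`ρ`: the distance `|cross v (c - p)| / ‖v‖` from `c` to the line equals `ρ`. -/
def LineTangentToCircle (p v c : ℂ) (ρ : ℝ) : Prop := |cross v (c - p)| = ρ * ‖v‖

/-- The graph of the outer length billiard map about `γ`. Here `γ x'` and `γ x` are the tangency points of
the positive and negative tangent segments from `A`; the circle of center `c` and radius `ρ` is
tangent to `γ` at `γ x'`, lies on the right of the ray from `A` through `γ x'`, and is tangent to the line
through `A` and `γ x`; the tangent line of `γ` at `γ x''` is the third common tangent line of the circle
and `γ`; and `A'` is its intersection point with the line through `A` and `γ x'`. -/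
def IsImage (γ : ℝ → ℂ) (A A' : ℂ) : Prop :=
  ∃ x x' x'' a a' ρ : ℝ, ∃ c : ℂ,
    0 < a' ∧ γ x' = A + a' * deriv γ x' ∧
    0 < a ∧ γ x = A - a * deriv γ x ∧
    0 < ρ ∧ c = γ x' - ρ * (Complex.I * (deriv γ x' / ‖deriv γ x'‖)) ∧
    LineTangentToCircle A (deriv γ x) c ρ ∧
    γ x'' ≠ γ x ∧ γ x'' ≠ γ x' ∧
    LineTangentToCircle (γ x'') (deriv γ x'') c ρ ∧
    cross (deriv γ x') (A' - γ x') = 0 ∧ cross (deriv γ x'') (A' - γ x'') = 0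

/-- The outer length billiard map `F` about `γ`. -/
noncomputable def billiardMap (γ : ℝ → ℂ) (A : ℂ) : ℂ := Classical.epsilon (IsImage γ A)

/-- The width `w(α)` of `γ`: the distance between its two support lines parallel to the direction
`(cos α, sin α)`. -/
noncomputable def width (γ : ℝ → ℂ) (α : ℝ) : ℝ :=
  (⨆ t, cross (Complex.exp (α * Complex.I)) (γ t)) - ⨅ t, cross (Complex.exp (α * Complex.I)) (γ t)

/-- The vector field `X = -(2 w(α) / r) ∂_α`, where `(α, r)` are the polar coordinates with origin `O`;
the coordinate field `∂_α` is `p ↦ i (p - O)`. -/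
noncomputable def field (γ : ℝ → ℂ) (O p : ℂ) : ℂ :=
  -((2 * width γ (Complex.arg (p - O)) / ‖p - O‖ : ℝ) : ℂ) * (Complex.I * (p - O))

/-- The graph of the time-1 flow of the vector field `field γ O` on the plane without the origin `O`. -/
def IsTimeOneFlow (γ : ℝ → ℂ) (O p q : ℂ) : Prop :=
  ∃ f : ℝ → ℂ, f 0 = p ∧ f 1 = q ∧
    ∀ t ∈ Set.Icc (0 : ℝ) 1, f t ≠ O ∧ HasDerivWithinAt f (field γ O (f t)) (Set.Icc 0 1) t

/-- The time-1 flow `Φ` of the vector field `field γ O`. -/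
noncomputable def timeOneFlow (γ : ℝ → ℂ) (O p : ℂ) : ℂ := Classical.epsilon (IsTimeOneFlow γ O p)

end OuterLength

/-!
The oval is reparametrized by the angle of its tangent vector: `Γ' φ = R φ * dir φ` with `0 < R ≤ M`
(`IsOval.exists_isAngleParam`). Strict convexity, `IsAngleParam.cross_pos`, and the properties of the
width `w φ = breadth Γ φ` then follow from this formula; the width is continuously differentiable with the
Lipschitz derivative `breadthDeriv Γ`.

A point of the exterior is the intersection of exactly one pair of a negative and a positive tangent line, at
`Γ φ₀` and `Γ φ₁` say, with `φ₀ < φ₁ < φ₀ + π`. Its image has the tangent lines at `Γ φ₁` and `Γ φ₂`, where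
`φ₂ ∈ (φ₁, φ₁ + π)` is determined by the circle of radius `ρ` that touches the curve from outside at `Γ φ₁`: if
`d₁` and `e₁` are the distances from `Γ φ₁` to the point and to its image, and `θ₁`, `θ₂` are the angles under
which these two points see the curve, then `d₁ = ρ tan (θ₁ / 2)` and `e₁ = ρ tan (θ₂ / 2)`. That there is
exactly one such `φ₂` is shown in `IsAngleParam.exists_common_tangent` and
`IsAngleParam.common_tangent_unique`, and `isImage_iff` is the translation of the definition of the map.

Far from the curve the angles are of the order `1 / d₁`, and `d₁ sin θ₁ = w φ₀`, `e₁ sin θ₂ = w φ₂` up to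
`O(1 / d₁²)`, because the curve is tangent to its support lines. As `φ₂ = φ₀ + 2π - θ₁ - θ₂` and `w` is
`π`-periodic, the relation `d₁ tan (θ₂ / 2) = e₁ tan (θ₁ / 2)` yields `e₁ - d₁ = -w' φ₁ + O(1 / d₁)`
(`isBigO_step`). The tangent segments from the image `B` satisfy `e₁ - d₂ = -w' φ₁ + O(1 / d₁)` too
(`TangentPair.abs_left_sub_right_add_le`). Hence in the displacement of the second iteration,
`(d₁ + e₁) dir φ₁ + (d₂ + e₂) dir φ₂`, the components along `dir φ₁` cancel up to `O(1 / d₁)`, and the component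
across is `2 w φ₁ + O(1 / d₁)` (`isBigO_two_steps`). This is the value of the vector field at the point, and
the flow moves along a circle with center `O`, on which the field is Lipschitz with a constant of the
order `1 / ‖A - O‖`, so that its time-1 map is the translation by the vector field up to `O(1 / ‖A - O‖)`.
For points at a bounded distance both maps have bounded displacement, by `SameCircle.exists_le`.
-/

namespace OuterLength
open Complex (I)
open Filter Asymptotics Topology

/-! ### The plane and curves parametrized by the angle of the tangent vector -/

/-- The unit vector `e^{iφ}`. -/
noncomputable def dir (φ : ℝ) : ℂ := Complex.exp (φ * I)

/-- The Euclidean scalar product of the plane `ℂ = ℝ²`. -/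
def dot (u v : ℂ) : ℝ := u.re * v.re + u.im * v.im

@[simp] lemma dir_re (φ : ℝ) : (dir φ).re = Real.cos φ := Complex.exp_ofReal_mul_I_re φ

@[simp] lemma dir_im (φ : ℝ) : (dir φ).im = Real.sin φ := Complex.exp_ofReal_mul_I_im φ

@[simp] lemma norm_dir (φ : ℝ) : ‖dir φ‖ = 1 := Complex.norm_exp_ofReal_mul_I φ

lemma dir_add (φ ψ : ℝ) : dir (φ + ψ) = dir φ * dir ψ := by
  simp [dir, add_mul, Complex.exp_add]

lemma dir_add_pi (φ : ℝ) : dir (φ + Real.pi) = -dir φ := by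
  apply Complex.ext <;> simp

lemma dir_periodic : Function.Periodic dir (2 * Real.pi) := by
  intro φ; apply Complex.ext <;> simp

lemma dir_ne_zero (φ : ℝ) : dir φ ≠ 0 := Complex.exp_ne_zero _

lemma dir_arg (z : ℂ) : (‖z‖ : ℂ) * dir z.arg = z := Complex.norm_mul_exp_arg_mul_I z

lemma hasDerivAt_dir (φ : ℝ) : HasDerivAt dir (I * dir φ) φ := by
  have h := ((Complex.ofRealCLM.hasDerivAt (x := φ)).mul_const I).cexp
  simp only [Complex.ofRealCLM_apply, Complex.ofReal_one, one_mul] at h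
  rw [mul_comm] at h
  exact h

lemma norm_dir_sub_le (φ ψ : ℝ) : ‖dir ψ - dir φ‖ ≤ |ψ - φ| := by
  have := Convex.norm_image_sub_le_of_norm_hasDerivWithin_le (f := dir) (s := Set.univ) (C := 1)
    (x := φ) (y := ψ) (fun x _ => (hasDerivAt_dir x).hasDerivWithinAt)
    (fun x _ => by simp) convex_univ trivial trivial
  simpa using this

lemma cross_dir_dir (φ ψ : ℝ) : cross (dir φ) (dir ψ) = Real.sin (ψ - φ) := by
  simp [cross, Real.sin_sub]; ring

lemma dot_dir_dir (φ ψ : ℝ) : dot (dir φ) (dir ψ) = Real.cos (ψ - φ) := by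
  simp [dot, Real.cos_sub]; ring

lemma cross_add_right (u v w : ℂ) : cross u (v + w) = cross u v + cross u w := by
  simp [cross]; ring

lemma cross_sub_right (u v w : ℂ) : cross u (v - w) = cross u v - cross u w := by
  simp [cross]; ring

lemma cross_mul_right (u : ℂ) (a : ℝ) (v : ℂ) : cross u (a * v) = a * cross u v := by
  simp [cross]; ring

lemma cross_mul_left (a : ℝ) (u v : ℂ) : cross (a * u) v = a * cross u v := by
  simp [cross]; ring

lemma cross_self (u : ℂ) : cross u u = 0 := by simp [cross]; ring

lemma cross_swap (u v : ℂ) : cross u v = -cross v u := by simp [cross]; ring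

lemma cross_sub_swap (u v w : ℂ) : cross u (v - w) = cross (w - v) u := by simp [cross]; ring

lemma dot_sub_right (u v w : ℂ) : dot u (v - w) = dot u v - dot u w := by
  simp [dot]; ring

lemma dot_add_right (u v w : ℂ) : dot u (v + w) = dot u v + dot u w := by
  simp [dot]; ring

lemma dot_mul_right (u : ℂ) (a : ℝ) (v : ℂ) : dot u (a * v) = a * dot u v := by
  simp [dot]; ring

lemma cross_I_mul_left (u v : ℂ) : cross (I * u) v = -dot u v := by
  simp [cross, dot]; ring

lemma abs_cross_le (u v : ℂ) : |cross u v| ≤ ‖u‖ * ‖v‖ := by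
  have h : cross u v = ((starRingEnd ℂ) u * v).im := by simp [cross]; ring
  rw [h]
  refine (Complex.abs_im_le_norm _).trans ?_
  simp

lemma abs_dot_le (u v : ℂ) : |dot u v| ≤ ‖u‖ * ‖v‖ := by
  have h : dot u v = ((starRingEnd ℂ) u * v).re := by simp [dot]
  rw [h]
  refine (Complex.abs_re_le_norm _).trans ?_
  simp

lemma abs_cross_dir_le (φ : ℝ) (v : ℂ) : |cross (dir φ) v| ≤ ‖v‖ := by
  simpa using abs_cross_le (dir φ) v

lemma abs_dot_dir_le (φ : ℝ) (v : ℂ) : |dot (dir φ) v| ≤ ‖v‖ := by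
  simpa using abs_dot_le (dir φ) v

/-- The coordinates of `v` in the orthonormal frame `dir φ`, `I * dir φ`. -/
lemma eq_dot_cross (φ : ℝ) (v : ℂ) :
    v = dot (dir φ) v * dir φ + cross (dir φ) v * (I * dir φ) := by
  have h := Real.sin_sq_add_cos_sq φ
  apply Complex.ext <;> simp <;> simp only [dot, cross, dir_re, dir_im]
  · linear_combination (-v.re) * h
  · linear_combination (-v.im) * h

lemma _root_.HasDerivAt.cross {f g : ℝ → ℂ} {f' g' : ℂ} {t : ℝ} (hf : HasDerivAt f f' t)
    (hg : HasDerivAt g g' t) :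
    HasDerivAt (fun s => OuterLength.cross (f s) (g s))
      (OuterLength.cross f' (g t) + OuterLength.cross (f t) g') t := by
  have hre {k : ℝ → ℂ} {k' : ℂ} (h : HasDerivAt k k' t) :
      HasDerivAt (fun s => (k s).re) k'.re t :=
    Complex.reCLM.hasFDerivAt.comp_hasDerivAt t h
  have him {k : ℝ → ℂ} {k' : ℂ} (h : HasDerivAt k k' t) :
      HasDerivAt (fun s => (k s).im) k'.im t :=
    Complex.imCLM.hasFDerivAt.comp_hasDerivAt t h
  have h := ((hre hf).mul (him hg)).sub ((him hf).mul (hre hg))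
  refine h.congr_deriv ?_
  simp only [OuterLength.cross]; ring

/-- `Γ` is a parametrization of a closed convex curve by the angle of its tangent vector, with radius
of curvature `R` bounded by `M`. -/
structure IsAngleParam (Γ : ℝ → ℂ) (R : ℝ → ℝ) (M : ℝ) : Prop where
  hasDerivAt : ∀ φ, HasDerivAt Γ (R φ * dir φ) φ
  pos : ∀ φ, 0 < R φ
  le : ∀ φ, R φ ≤ M
  periodic : Function.Periodic Γ (2 * Real.pi)

/-- The width of the curve `Γ` in the direction `dir φ`: the signed distance between its tangent lines at
`Γ φ` and `Γ (φ + π)`. -/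
noncomputable def breadth (Γ : ℝ → ℂ) (φ : ℝ) : ℝ := cross (dir φ) (Γ (φ + Real.pi) - Γ φ)

/-- The derivative of `breadth Γ`. -/
noncomputable def breadthDeriv (Γ : ℝ → ℂ) (φ : ℝ) : ℝ := -dot (dir φ) (Γ (φ + Real.pi) - Γ φ)

namespace IsAngleParam

variable {Γ : ℝ → ℂ} {R : ℝ → ℝ} {M : ℝ}

lemma bound_pos (h : IsAngleParam Γ R M) : 0 < M := (h.pos 0).trans_le (h.le 0)

lemma norm_sub_le (h : IsAngleParam Γ R M) (φ ψ : ℝ) : ‖Γ ψ - Γ φ‖ ≤ M * |ψ - φ| := by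
  have := Convex.norm_image_sub_le_of_norm_hasDerivWithin_le (f := Γ) (s := Set.univ) (C := M)
    (x := φ) (y := ψ) (fun x _ => (h.hasDerivAt x).hasDerivWithinAt)
    (fun x _ => by simpa [abs_of_pos (h.pos x)] using h.le x) convex_univ trivial trivial
  simpa using this

/-- Any parameter is congruent modulo `2π` to one in `[φ, φ + 2π)`. -/
lemma exists_shift (h : IsAngleParam Γ R M) (φ ψ : ℝ) :
    ∃ χ, φ ≤ χ ∧ χ < φ + 2 * Real.pi ∧ Γ χ = Γ ψ ∧ dir χ = dir ψ := by
  obtain ⟨n, hn, -⟩ := existsUnique_add_zsmul_mem_Ico Real.two_pi_pos ψ φ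
  exact ⟨ψ + n • (2 * Real.pi), hn.1, hn.2, h.periodic.zsmul n ψ, dir_periodic.zsmul n ψ⟩

lemma norm_sub_le_diam (h : IsAngleParam Γ R M) (φ ψ : ℝ) : ‖Γ ψ - Γ φ‖ ≤ 2 * Real.pi * M := by
  obtain ⟨χ, h1, h2, h3, -⟩ := h.exists_shift φ ψ
  rw [← h3]
  refine (h.norm_sub_le φ χ).trans ?_
  rw [abs_of_nonneg (by linarith)]
  nlinarith [h.bound_pos]

lemma hasDerivAt_cross (h : IsAngleParam Γ R M) (v : ℂ) (φ : ℝ) :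
    HasDerivAt (fun s => cross v (Γ s)) (R φ * cross v (dir φ)) φ := by
  have := (hasDerivAt_const φ v).cross (h.hasDerivAt φ)
  convert this using 1
  simp [cross]; ring

/-- Strict convexity: the curve lies strictly to the left of its tangent line at `Γ φ`, except for the
tangency point. -/
lemma cross_pos (h : IsAngleParam Γ R M) {φ ψ : ℝ} (h1 : φ < ψ) (h2 : ψ < φ + 2 * Real.pi) :
    0 < cross (dir φ) (Γ ψ - Γ φ) := by
  have hπ := Real.pi_pos
  have hd := h.hasDerivAt_cross (dir φ)
  have hc : Continuous fun s => cross (dir φ) (Γ s) :=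
    continuous_iff_continuousAt.2 fun s => (hd s).continuousAt
  rw [cross_sub_right, sub_pos]
  rcases le_total ψ (φ + Real.pi) with h3 | h3
  · refine strictMonoOn_of_deriv_pos (convex_Icc φ (φ + Real.pi)) hc.continuousOn ?_
      ⟨le_rfl, by linarith⟩ ⟨h1.le, h3⟩ h1
    intro s hs
    rw [interior_Icc] at hs
    rw [(hd s).deriv, cross_dir_dir]
    exact mul_pos (h.pos s) (Real.sin_pos_of_pos_of_lt_pi (by linarith [hs.1]) (by linarith [hs.2]))
  · rw [← h.periodic φ]
    refine strictAntiOn_of_deriv_neg (convex_Icc (φ + Real.pi) (φ + 2 * Real.pi))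
      hc.continuousOn ?_ ⟨h3, h2.le⟩ ⟨by linarith, le_rfl⟩ h2
    intro s hs
    rw [interior_Icc] at hs
    rw [(hd s).deriv, cross_dir_dir]
    refine mul_neg_of_pos_of_neg (h.pos s) ?_
    rw [← Real.sin_sub_two_pi]
    exact Real.sin_neg_of_neg_of_neg_pi_lt (by linarith [hs.2]) (by linarith [hs.1])

lemma cross_nonneg (h : IsAngleParam Γ R M) (φ ψ : ℝ) : 0 ≤ cross (dir φ) (Γ ψ - Γ φ) := by
  obtain ⟨χ, h1, h2, h3, -⟩ := h.exists_shift φ ψ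
  rw [← h3]
  rcases h1.eq_or_lt with h1 | h1
  · simp [← h1, cross]
  · exact (h.cross_pos h1 h2).le

lemma cross_pos_of_ne (h : IsAngleParam Γ R M) {φ ψ : ℝ} (hne : Γ ψ ≠ Γ φ) :
    0 < cross (dir φ) (Γ ψ - Γ φ) := by
  obtain ⟨χ, h1, h2, h3, -⟩ := h.exists_shift φ ψ
  rw [← h3] at hne ⊢
  exact h.cross_pos (h1.lt_of_ne fun h => hne (by rw [h])) h2

/-- Near the point opposite to `Γ φ`, the distance to the tangent line at `Γ φ` is stationary. -/
lemma abs_cross_sub_opposite_le (h : IsAngleParam Γ R M) (φ ψ : ℝ) :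
    |cross (dir φ) (Γ ψ - Γ (φ + Real.pi))| ≤ M * (ψ - φ - Real.pi) ^ 2 := by
  rw [cross_sub_right]
  have key := Convex.norm_image_sub_le_of_norm_hasDerivWithin_le (f := fun s => cross (dir φ) (Γ s))
    (s := Set.uIcc (φ + Real.pi) ψ) (C := M * |ψ - φ - Real.pi|)
    (x := φ + Real.pi) (y := ψ)
    (fun x _ => (h.hasDerivAt_cross (dir φ) x).hasDerivWithinAt)
    (fun x hx => by
      rw [cross_dir_dir, Real.norm_eq_abs, abs_mul, abs_of_pos (h.pos x)]
      refine mul_le_mul (h.le x) ?_ (abs_nonneg _) h.bound_pos.le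
      have h1 : |Real.sin (x - φ)| = |Real.sin (x - φ - Real.pi)| := by
        rw [Real.sin_sub_pi, abs_neg]
      rw [h1]
      refine Real.abs_sin_le_abs.trans ?_
      have := Set.abs_sub_left_of_mem_uIcc hx
      rwa [← sub_sub, ← sub_sub] at this)
    (convex_uIcc _ _) Set.left_mem_uIcc Set.right_mem_uIcc
  rw [Real.norm_eq_abs, Real.norm_eq_abs] at key
  refine key.trans (le_of_eq ?_)
  rw [← sub_sub, mul_assoc, ← sq, sq_abs]

lemma opposite_add_pi (h : IsAngleParam Γ R M) (φ : ℝ) : Γ (φ + Real.pi + Real.pi) = Γ φ := by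
  rw [add_assoc, ← two_mul, h.periodic]

lemma breadth_add_pi (h : IsAngleParam Γ R M) (φ : ℝ) :
    breadth Γ (φ + Real.pi) = breadth Γ φ := by
  rw [breadth, breadth, h.opposite_add_pi, dir_add_pi]
  simp [cross]; ring

lemma breadthDeriv_add_pi (h : IsAngleParam Γ R M) (φ : ℝ) :
    breadthDeriv Γ (φ + Real.pi) = breadthDeriv Γ φ := by
  rw [breadthDeriv, breadthDeriv, h.opposite_add_pi, dir_add_pi]
  simp [dot]; ring

lemma breadth_pos (h : IsAngleParam Γ R M) (φ : ℝ) : 0 < breadth Γ φ :=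
  h.cross_pos (by linarith [Real.pi_pos]) (by linarith [Real.pi_pos])

lemma abs_breadth_le (h : IsAngleParam Γ R M) (φ : ℝ) : |breadth Γ φ| ≤ 2 * Real.pi * M :=
  (abs_cross_dir_le _ _).trans (h.norm_sub_le_diam _ _)

lemma abs_breadthDeriv_le (h : IsAngleParam Γ R M) (φ : ℝ) :
    |breadthDeriv Γ φ| ≤ 2 * Real.pi * M := by
  rw [breadthDeriv, abs_neg]
  exact (abs_dot_dir_le _ _).trans (h.norm_sub_le_diam _ _)

/-- The width is the length of the projection of the curve. -/
lemma cross_le_breadth (h : IsAngleParam Γ R M) (φ s t : ℝ) :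
    cross (dir φ) (Γ s - Γ t) ≤ breadth Γ φ := by
  have h1 := h.cross_nonneg φ t
  have h2 := h.cross_nonneg (φ + Real.pi) s
  rw [dir_add_pi] at h2
  simp only [breadth, cross, Complex.neg_re, Complex.neg_im, Complex.sub_re, Complex.sub_im] at *
  linarith

/-- The width is a Lipschitz function of the unit vector `dir φ`. -/
lemma abs_breadth_sub_le (h : IsAngleParam Γ R M) (φ ψ : ℝ) :
    |breadth Γ φ - breadth Γ ψ| ≤ 2 * Real.pi * M * ‖dir φ - dir ψ‖ := by
  have key (φ ψ : ℝ) : breadth Γ φ - breadth Γ ψ ≤ 2 * Real.pi * M * ‖dir φ - dir ψ‖ := by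
    have h1 := h.cross_le_breadth ψ (φ + Real.pi) φ
    have h2 := (le_abs_self _).trans (abs_cross_le (dir φ - dir ψ) (Γ (φ + Real.pi) - Γ φ))
    have h3 := mul_le_mul_of_nonneg_left (h.norm_sub_le_diam φ (φ + Real.pi))
      (norm_nonneg (dir φ - dir ψ))
    have h4 : cross (dir φ - dir ψ) (Γ (φ + Real.pi) - Γ φ)
        = breadth Γ φ - cross (dir ψ) (Γ (φ + Real.pi) - Γ φ) := by
      simp [breadth, cross]; ring
    linarith
  refine abs_le.2 ⟨?_, key φ ψ⟩
  have := key ψ φ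
  rw [norm_sub_rev] at this
  linarith

lemma hasDerivAt_breadth (h : IsAngleParam Γ R M) (φ : ℝ) :
    HasDerivAt (breadth Γ) (breadthDeriv Γ φ) φ := by
  have h1 := (h.hasDerivAt (φ + Real.pi)).comp_add_const φ Real.pi
  have := (hasDerivAt_dir φ).cross (h1.sub (h.hasDerivAt φ))
  refine this.congr_deriv ?_
  rw [dir_add_pi, cross_I_mul_left, breadthDeriv]
  simp [cross]; ring

lemma continuous_breadth (h : IsAngleParam Γ R M) : Continuous (breadth Γ) :=
  continuous_iff_continuousAt.2 fun φ => (h.hasDerivAt_breadth φ).continuousAt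

lemma exists_le_breadth (h : IsAngleParam Γ R M) : ∃ c, 0 < c ∧ ∀ φ, c ≤ breadth Γ φ := by
  obtain ⟨x, -, hx⟩ := isCompact_Icc.exists_isMinOn
    (Set.nonempty_Icc.2 (Real.pi_pos.le)) h.continuous_breadth.continuousOn
  refine ⟨breadth Γ x, h.breadth_pos x, fun φ => ?_⟩
  obtain ⟨y, hy, h2⟩ := (show Function.Periodic (breadth Γ) Real.pi from h.breadth_add_pi).exists_mem_Ico₀
    Real.pi_pos φ
  rw [h2]
  exact hx ⟨hy.1, hy.2.le⟩

lemma abs_breadthDeriv_sub_le (h : IsAngleParam Γ R M) (φ ψ : ℝ) :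
    |breadthDeriv Γ ψ - breadthDeriv Γ φ| ≤ (2 * Real.pi * M + 2 * M) * |ψ - φ| := by
  set P := Γ (φ + Real.pi) - Γ φ
  set Q := Γ (ψ + Real.pi) - Γ ψ
  have e : breadthDeriv Γ ψ - breadthDeriv Γ φ = dot (dir φ - dir ψ) P + dot (dir ψ) (P - Q) := by
    simp only [breadthDeriv, P, Q]; simp [dot]; ring
  have h1 : |dot (dir φ - dir ψ) P| ≤ |ψ - φ| * (2 * Real.pi * M) :=
    (abs_dot_le _ _).trans (mul_le_mul (by rw [norm_sub_rev]; exact norm_dir_sub_le φ ψ)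
      (h.norm_sub_le_diam _ _) (norm_nonneg _) (abs_nonneg _))
  have h2 : |dot (dir ψ) (P - Q)| ≤ 2 * M * |ψ - φ| := by
    refine (abs_dot_dir_le _ _).trans ?_
    have e2 : P - Q = (Γ ψ - Γ φ) - (Γ (ψ + Real.pi) - Γ (φ + Real.pi)) := by
      simp only [P, Q]; ring
    have h3 := h.norm_sub_le (φ + Real.pi) (ψ + Real.pi)
    rw [add_sub_add_right_eq_sub] at h3
    rw [e2]
    refine (_root_.norm_sub_le _ _).trans ?_
    linarith [h.norm_sub_le φ ψ]
  rw [e]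
  refine (abs_add_le _ _).trans ?_
  linarith

/-- First-order Taylor expansion of the width, with a quadratic remainder. -/
lemma abs_breadth_taylor_le (h : IsAngleParam Γ R M) (φ ψ : ℝ) :
    |breadth Γ ψ - breadth Γ φ - breadthDeriv Γ φ * (ψ - φ)|
      ≤ (2 * Real.pi * M + 2 * M) * (ψ - φ) ^ 2 := by
  have key := Convex.norm_image_sub_le_of_norm_hasDerivWithin_le
    (f := fun s => breadth Γ s - breadthDeriv Γ φ * s)
    (f' := fun s => breadthDeriv Γ s - breadthDeriv Γ φ)
    (s := Set.uIcc φ ψ) (C := (2 * Real.pi * M + 2 * M) * |ψ - φ|) (x := φ) (y := ψ)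
    (fun x _ => by
      have := (h.hasDerivAt_breadth x).sub ((hasDerivAt_id x).const_mul (breadthDeriv Γ φ))
      rw [mul_one] at this
      exact this.hasDerivWithinAt)
    (fun x hx => by
      refine (h.abs_breadthDeriv_sub_le φ x).trans ?_
      have := h.bound_pos
      refine mul_le_mul_of_nonneg_left ?_ (by positivity)
      exact Set.abs_sub_left_of_mem_uIcc hx)
    (convex_uIcc _ _) Set.left_mem_uIcc Set.right_mem_uIcc
  rw [Real.norm_eq_abs, Real.norm_eq_abs, mul_assoc, ← sq, sq_abs] at key
  convert key using 2
  ring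

end IsAngleParam

/-! ### Ovals are parametrized by the angle of the tangent vector -/

namespace IsOval

variable {γ : ℝ → ℂ} {T : ℝ}

lemma deriv_ne_zero (h : IsOval γ T) (t : ℝ) : deriv γ t ≠ 0 := by
  intro h0
  have := h.curvature_pos t
  simp [h0, cross] at this

lemma hasDerivAt (h : IsOval γ T) (t : ℝ) : HasDerivAt γ (deriv γ t) t :=
  (h.smooth.differentiable (by simp) t).hasDerivAt

lemma contDiff_deriv (h : IsOval γ T) : ContDiff ℝ (⊤ : ℕ∞) (deriv γ) :=
  ContDiff.iterate_deriv 1 h.smooth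

lemma hasDerivAt_deriv (h : IsOval γ T) (t : ℝ) :
    HasDerivAt (deriv γ) (deriv (deriv γ) t) t :=
  (h.contDiff_deriv.differentiable (by simp) t).hasDerivAt

lemma continuous_deriv_deriv (h : IsOval γ T) : Continuous (deriv (deriv γ)) :=
  h.contDiff_deriv.continuous_deriv (by simp)

lemma deriv_periodic (h : IsOval γ T) : Function.Periodic (deriv γ) T := by
  intro t
  rw [← deriv_comp_add_const]
  exact congrArg (fun f => deriv f t) (funext h.periodic)

lemma deriv_deriv_periodic (h : IsOval γ T) : Function.Periodic (deriv (deriv γ)) T := by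
  intro t
  rw [← deriv_comp_add_const]
  exact congrArg (fun f => deriv f t) (funext h.deriv_periodic)

/-- A point of the curve that lies on the tangent line at `γ t` is `γ t`: the function
`τ ↦ cross (γ' τ) (γ s - γ τ)` has a minimum at `t`, hence `cross (γ'' t) (γ s - γ t) = 0` too. -/
lemma eq_of_cross_eq_zero (h : IsOval γ T) {s t : ℝ}
    (h0 : cross (deriv γ t) (γ s - γ t) = 0) : γ s = γ t := by
  have hd := (h.hasDerivAt_deriv t).cross ((hasDerivAt_const t (γ s)).sub (h.hasDerivAt t))
  have hmin : IsLocalMin (fun τ => cross (deriv γ τ) (γ s - γ τ)) t := by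
    refine Filter.Eventually.of_forall fun τ => ?_
    change cross (deriv γ t) (γ s - γ t) ≤ cross (deriv γ τ) (γ s - γ τ)
    rw [h0]
    exact h.convex s τ
  have h1 := hmin.hasDerivAt_eq_zero hd
  have h2 := h.curvature_pos t
  simp only [cross, Pi.sub_apply, Complex.sub_re, Complex.sub_im, Complex.zero_re,
    Complex.zero_im] at h0 h1 h2
  set a := deriv γ t
  set b := deriv (deriv γ) t
  have hre : ((γ s).re - (γ t).re) * (a.re * b.im - a.im * b.re) = 0 := by
    linear_combination b.re * h0 - a.re * h1
  have him : ((γ s).im - (γ t).im) * (a.re * b.im - a.im * b.re) = 0 := by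
    linear_combination b.im * h0 - a.im * h1
  apply Complex.ext
  · linarith [(mul_eq_zero.1 hre).resolve_right h2.ne']
  · linarith [(mul_eq_zero.1 him).resolve_right h2.ne']

/-- A continuously differentiable, strictly increasing lift of the angle of the tangent vector. -/
lemma exists_angle (h : IsOval γ T) : ∃ θ κ : ℝ → ℝ, (∀ t, HasDerivAt θ (κ t) t) ∧
    Continuous κ ∧ Function.Periodic κ T ∧ (∀ t, 0 < κ t) ∧
    ∀ t, deriv γ t = ‖deriv γ t‖ * dir (θ t) := by
  have hk : Continuous fun t => deriv (deriv γ) t / deriv γ t :=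
    h.continuous_deriv_deriv.div h.contDiff_deriv.continuous h.deriv_ne_zero
  -- the complex logarithm of `γ'` is a primitive of `γ'' / γ'`
  set F : ℝ → ℂ := fun t => ∫ s in (0:ℝ)..t, deriv (deriv γ) s / deriv γ s with hF
  have hFd (t : ℝ) : HasDerivAt F (deriv (deriv γ) t / deriv γ t) t :=
    (hk.integral_hasStrictDerivAt 0 t).hasDerivAt
  have hexp (t : ℝ) : deriv γ t = deriv γ 0 * Complex.exp (F t) := by
    have hd (t : ℝ) : HasDerivAt (fun t => deriv γ t * Complex.exp (-F t)) 0 t := by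
      refine ((h.hasDerivAt_deriv t).mul (hFd t).neg.cexp).congr_deriv ?_
      have := h.deriv_ne_zero t
      field_simp
      ring
    have := is_const_of_deriv_eq_zero (fun t => (hd t).differentiableAt) (fun t => (hd t).deriv) t 0
    have hF0 : F 0 = 0 := by simp [hF]
    rw [hF0, neg_zero, Complex.exp_zero, mul_one] at this
    rw [← this, mul_assoc, ← Complex.exp_add]
    simp
  have him (t : ℝ) : (deriv (deriv γ) t / deriv γ t).im
      = cross (deriv γ t) (deriv (deriv γ) t) / Complex.normSq (deriv γ t) := by
    rw [Complex.div_im]; simp only [cross]; ring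
  refine ⟨fun t => Complex.arg (deriv γ 0) + (F t).im, fun t => (deriv (deriv γ) t / deriv γ t).im,
    fun t => ?_, Complex.continuous_im.comp hk, fun t => ?_, fun t => ?_, fun t => ?_⟩
  · exact (Complex.imCLM.hasFDerivAt.comp_hasDerivAt t (hFd t)).const_add _
  · simp only [h.deriv_periodic t, h.deriv_deriv_periodic t]
  · simp only [him]
    exact div_pos (h.curvature_pos t) (Complex.normSq_pos.2 (h.deriv_ne_zero t))
  · rw [hexp t, norm_mul, Complex.norm_exp, dir_add]
    nth_rewrite 1 [← dir_arg (deriv γ 0)]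
    nth_rewrite 1 [← Complex.re_add_im (F t)]
    rw [Complex.exp_add, ← Complex.ofReal_exp]
    push_cast
    simp only [dir]
    ring

/-- An oval can be parametrized by the angle of its tangent vector. -/
theorem exists_isAngleParam (h : IsOval γ T) : ∃ (Γ : ℝ → ℂ) (R : ℝ → ℝ) (M : ℝ) (θ : ℝ → ℝ),
    IsAngleParam Γ R M ∧ Function.Surjective θ ∧ (∀ t, γ t = Γ (θ t)) ∧
    ∀ t, deriv γ t = ‖deriv γ t‖ * dir (θ t) := by
  obtain ⟨θ, κ, hθ, hκc, hκp, hκ, hdir⟩ := h.exists_angle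
  have hT := h.period_pos
  have hmono : StrictMono θ := strictMono_of_hasDerivAt_pos hθ hκ
  have hθc : Continuous θ := continuous_iff_continuousAt.2 fun t => (hθ t).continuousAt
  have hnorm (t : ℝ) : (‖deriv γ t‖ : ℂ) ≠ 0 := by simpa using h.deriv_ne_zero t
  -- the total rotation in a period is a multiple of `2π`
  have hrot (t : ℝ) : θ (t + T) = θ t + (θ T - θ 0) := by
    have hd (t : ℝ) : HasDerivAt (fun t => θ (t + T) - θ t) 0 t := by
      refine (((hθ (t + T)).comp_add_const t T).sub (hθ t)).congr_deriv ?_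
      rw [hκp, sub_self]
    have := is_const_of_deriv_eq_zero (fun t => (hd t).differentiableAt) (fun t => (hd t).deriv) t 0
    simp only [zero_add] at this
    linarith
  obtain ⟨n, hn⟩ : ∃ n : ℤ, θ T = θ 0 + n * (2 * Real.pi) := by
    have h1 := hdir T
    have h2 := hdir 0
    have h3 := h.deriv_periodic 0
    rw [zero_add] at h3
    rw [h3] at h1
    have h4 : dir (θ T) = dir (θ 0) := mul_left_cancel₀ (hnorm 0) (h1.symm.trans h2)
    obtain ⟨n, hn⟩ := Complex.exp_eq_exp_iff_exists_int.1 h4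
    refine ⟨n, ?_⟩
    have h5 : ((θ T : ℝ) : ℂ) * I = ((θ 0 + n * (2 * Real.pi) : ℝ) : ℂ) * I := by
      rw [hn]; push_cast; ring
    exact_mod_cast mul_right_cancel₀ Complex.I_ne_zero h5
  have hπ := Real.pi_pos
  have hn1 : n = 1 := by
    have hlt := hmono hT
    have hpos : 0 < n := by
      by_contra hcon
      have : (n : ℝ) ≤ 0 := by exact_mod_cast not_lt.1 hcon
      nlinarith
    by_contra hne
    have h2 : (2 : ℝ) ≤ n := by exact_mod_cast (show 2 ≤ n by omega)
    -- otherwise two points of the curve in a period have the same oriented tangent direction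
    obtain ⟨s, hs, hs2⟩ : θ 0 + 2 * Real.pi ∈ θ '' Set.Ioo 0 T :=
      intermediate_value_Ioo hT.le hθc.continuousOn ⟨by linarith, by nlinarith⟩
    have h3 : cross (deriv γ 0) (γ s - γ 0) = 0 := by
      refine le_antisymm ?_ (h.convex s 0)
      have h4 := h.convex 0 s
      rw [hdir s, hs2, dir_periodic, cross_mul_left] at h4
      rw [hdir 0, cross_mul_left]
      have h5 := norm_pos_iff.2 (h.deriv_ne_zero s)
      have h6 := (mul_nonneg_iff_of_pos_left h5).1 h4
      rw [← neg_sub] at h6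
      have h7 : cross (dir (θ 0)) (-(γ s - γ 0)) = -cross (dir (θ 0)) (γ s - γ 0) := by
        simp [cross]; ring
      exact mul_nonpos_of_nonneg_of_nonpos (norm_nonneg _) (by linarith)
    have := h.simple ⟨hs.1.le, hs.2⟩ ⟨le_rfl, hT⟩ (h.eq_of_cross_eq_zero h3)
    exact hs.1.ne' this
  subst hn1
  have hper (t : ℝ) : θ (t + T) = θ t + 2 * Real.pi := by
    rw [hrot t, hn]; push_cast; ring
  have hsurj : Function.Surjective θ := by
    have hnat (n : ℤ) : θ (n • T) = θ 0 + n * (2 * Real.pi) := by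
      induction n using Int.induction_on with
      | zero => simp
      | succ k ih => rw [add_smul, one_smul, hper, ih]; push_cast; ring
      | pred k ih =>
        have := hper ((-(k : ℤ) - 1) • T)
        rw [sub_smul, one_smul, sub_add_cancel, ih] at this
        rw [sub_smul, one_smul]
        push_cast at this ⊢
        linarith
    intro φ
    obtain ⟨k, hk⟩ := exists_int_lt ((φ - θ 0) / (2 * Real.pi))
    obtain ⟨m, hm⟩ := exists_int_gt ((φ - θ 0) / (2 * Real.pi))
    rw [lt_div_iff₀ (by positivity)] at hk
    rw [div_lt_iff₀ (by positivity)] at hm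
    exact mem_range_of_exists_le_of_exists_ge hθc ⟨k • T, by rw [hnat]; linarith⟩
      ⟨m • T, by rw [hnat]; linarith⟩
  set e := hmono.orderIsoOfSurjective θ hsurj
  have he (φ : ℝ) : θ (e.symm φ) = φ := e.apply_symm_apply φ
  have he2 (t : ℝ) : e.symm (θ t) = t := e.symm_apply_apply t
  have hinv (φ : ℝ) : HasDerivAt e.symm (κ (e.symm φ))⁻¹ φ :=
    (hθ (e.symm φ)).of_local_left_inverse e.symm.continuous.continuousAt (hκ _).ne'
      (Filter.Eventually.of_forall he)
  have hr : Continuous fun t => ‖deriv γ t‖ / κ t :=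
    h.contDiff_deriv.continuous.norm.div hκc fun t => (hκ t).ne'
  have hrp : Function.Periodic (fun t => ‖deriv γ t‖ / κ t) T := fun t => by
    simp only [h.deriv_periodic t, hκp t]
  obtain ⟨x, -, hx⟩ := isCompact_Icc.exists_isMaxOn (Set.nonempty_Icc.2 hT.le) hr.continuousOn
  refine ⟨fun φ => γ (e.symm φ), fun φ => ‖deriv γ (e.symm φ)‖ / κ (e.symm φ),
    ‖deriv γ x‖ / κ x, θ, ⟨fun φ => ?_, fun φ => ?_, fun φ => ?_, fun φ => ?_⟩, hsurj,
    fun t => by simp only [he2], hdir⟩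
  · refine ((h.hasDerivAt (e.symm φ)).scomp φ (hinv φ)).congr_deriv ?_
    rw [hdir (e.symm φ), he, Complex.real_smul]
    simp
    ring
  · exact div_pos (norm_pos_iff.2 (h.deriv_ne_zero _)) (hκ _)
  · obtain ⟨y, hy, h2⟩ := hrp.exists_mem_Ico₀ hT (e.symm φ)
    exact h2.le.trans (hx ⟨hy.1, hy.2.le⟩)
  · rw [← h.periodic (e.symm φ), ← he2 (e.symm φ + T), hper, he]

end IsOval

/-! ### The billiard map in terms of the angles of the tangent lines -/

/-- `Γ φ` and `Γ ψ` are the tangency points of the negative and the positive tangent segments from `A`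
to `Γ`, of lengths `e` and `d`, with `φ` and `ψ` chosen such that the curve turns by less than `π` between
them. -/
structure TangentPair (Γ : ℝ → ℂ) (φ ψ : ℝ) (A : ℂ) (e d : ℝ) : Prop where
  lt : φ < ψ
  lt_add_pi : ψ < φ + Real.pi
  eq_left : A = Γ φ + e * dir φ
  eq_right : A = Γ ψ - d * dir ψ

lemma cross_dir_I_mul_dir (φ ψ : ℝ) : cross (dir φ) (I * dir ψ) = Real.cos (ψ - φ) := by
  simp [cross, Real.cos_sub]; ring

/-- If `z` is on the line through `p` in the direction `dir φ`, then `dot` gives its coordinate there. -/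
lemma eq_add_of_cross_eq_zero {φ : ℝ} {z p : ℂ} (h : cross (dir φ) (z - p) = 0) :
    z = p + dot (dir φ) (z - p) * dir φ := by
  have := eq_dot_cross φ (z - p)
  rw [h] at this
  simp only [Complex.ofReal_zero, zero_mul, add_zero] at this
  rw [← this]; ring

lemma sin_add_sin_add_sub_sin (δ η : ℝ) : Real.sin η + Real.sin (δ + η) - Real.sin δ
    = 4 * Real.cos ((δ + η) / 2) * Real.sin (η / 2) * Real.cos (δ / 2) := by
  have e1 : Real.sin η = Real.sin (2 * (η / 2)) := by ring_nf
  have e2 : Real.sin δ = Real.sin (2 * (δ / 2)) := by ring_nf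
  have e3 : Real.sin (δ + η) = Real.sin (2 * (δ / 2 + η / 2)) := by ring_nf
  have e4 : Real.cos ((δ + η) / 2) = Real.cos (δ / 2 + η / 2) := by ring_nf
  rw [e1, e2, e3, e4]
  simp only [Real.sin_two_mul, Real.sin_add, Real.cos_add]
  have h1 := Real.sin_sq_add_cos_sq (δ / 2)
  have h2 := Real.sin_sq_add_cos_sq (η / 2)
  set a := Real.sin (δ / 2)
  set b := Real.cos (δ / 2)
  set c := Real.sin (η / 2)
  set d := Real.cos (η / 2)
  linear_combination (-2 * c * d) * h1 + 2 * a * b * h2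

namespace IsAngleParam

variable {Γ : ℝ → ℂ} {R : ℝ → ℝ} {M : ℝ} {φ ψ e d : ℝ} {A : ℂ}

/-- A point of a tangent line that is to the left of all tangent lines is the tangency point. -/
lemma eq_of_cross_eq_zero (h : IsAngleParam Γ R M) (hA : ∀ s, 0 ≤ cross (dir s) (A - Γ s))
    (h0 : cross (dir φ) (A - Γ φ) = 0) : A = Γ φ := by
  have hd := (hasDerivAt_dir φ).cross ((hasDerivAt_const φ A).sub (h.hasDerivAt φ))
  have hmin : IsLocalMin (fun s => cross (dir s) (A - Γ s)) φ := by
    refine Filter.Eventually.of_forall fun s => ?_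
    change cross (dir φ) (A - Γ φ) ≤ cross (dir s) (A - Γ s)
    rw [h0]
    exact hA s
  have h1 := hmin.hasDerivAt_eq_zero hd
  have h2 : cross (dir φ) (0 - R φ * dir φ) = 0 := by simp [cross]; ring
  rw [h2, add_zero, cross_I_mul_left, neg_eq_zero, Pi.sub_apply] at h1
  rw [eq_add_of_cross_eq_zero h0, h1]
  simp

/-- The region bounded by the curve is the intersection of its supporting half-planes. -/
lemma mem_table_iff (h : IsAngleParam Γ R M) :
    A ∈ table Γ ↔ ∀ φ, 0 ≤ cross (dir φ) (A - Γ φ) := by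
  constructor
  · intro hA φ
    have hconv : Convex ℝ {z | 0 ≤ cross (dir φ) (z - Γ φ)} := by
      intro x hx y hy a b ha hb hab
      have e : cross (dir φ) (a • x + b • y - Γ φ)
          = a * cross (dir φ) (x - Γ φ) + b * cross (dir φ) (y - Γ φ) := by
        obtain rfl : b = 1 - a := by linarith
        simp [cross]; ring
      rw [Set.mem_ofPred_eq, e]
      exact add_nonneg (mul_nonneg ha hx) (mul_nonneg hb hy)
    refine convexHull_min ?_ hconv hA
    rintro _ ⟨ψ, rfl⟩
    exact h.cross_nonneg φ ψ
  · intro hA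
    have hmem (s : ℝ) : Γ s ∈ table Γ := subset_convexHull ℝ _ ⟨s, rfl⟩
    rcases (hA 0).eq_or_lt with h0 | h0
    · rw [h.eq_of_cross_eq_zero hA h0.symm]
      exact hmem 0
    -- the line through `Γ 0` and `A` meets the curve again at a point `Γ ψ` behind `A`
    obtain ⟨β, hβ1, hβ2, -, hβ⟩ := h.exists_shift 0 (A - Γ 0).arg
    set r := ‖A - Γ 0‖
    have hAr : A - Γ 0 = r * dir β := by rw [hβ, dir_arg]
    rw [hAr, cross_mul_right, cross_dir_dir, sub_zero] at h0
    have hsin : 0 < Real.sin β := pos_of_mul_pos_right h0 (norm_nonneg _)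
    have hr : 0 < r := pos_of_mul_pos_left h0 hsin.le
    have hβ3 : 0 < β := hβ1.lt_of_ne fun h => by simp [← h] at hsin
    have hβ4 : β < Real.pi := by
      by_contra hcon
      have := Real.sin_nonneg_of_nonneg_of_le_pi (x := β - Real.pi) (by linarith) (by linarith)
      rw [Real.sin_sub_pi] at this
      linarith
    set k : ℝ → ℝ := fun s => cross (dir β) (Γ s - Γ 0) with hk
    have hkc : Continuous k := by
      simp only [hk, cross_sub_right]
      exact (continuous_iff_continuousAt.2 fun s =>
        (h.hasDerivAt_cross (dir β) s).continuousAt).sub continuous_const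
    obtain ⟨ψ, hψ, hψ0⟩ : 0 ∈ k '' Set.Ioo β (β + Real.pi) := by
      refine intermediate_value_Ioo (by linarith) hkc.continuousOn ⟨?_, ?_⟩
      · have := h.cross_pos (φ := β) (ψ := 0 + 2 * Real.pi) (by linarith) (by linarith)
        rw [h.periodic, cross_sub_right] at this
        simp only [hk, cross_sub_right]
        linarith
      · have := h.cross_pos (φ := β + Real.pi) (ψ := 0 + 2 * Real.pi) (by linarith) (by linarith)
        rw [h.periodic, cross_sub_right, dir_add_pi] at this
        simp only [hk, cross] at this ⊢
        simp only [Complex.neg_re, Complex.neg_im, Complex.sub_re, Complex.sub_im] at this ⊢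
        linarith
    set s := dot (dir β) (Γ ψ - Γ 0)
    have hψs : Γ ψ - Γ 0 = s * dir β := by
      rw [sub_eq_iff_eq_add']
      exact eq_add_of_cross_eq_zero hψ0
    have h1 := h.cross_pos (φ := 0) (ψ := ψ) (by linarith [hψ.1]) (by linarith [hψ.2])
    rw [hψs, cross_mul_right, cross_dir_dir, sub_zero] at h1
    have hs : 0 < s := pos_of_mul_pos_left h1 hsin.le
    have hrs : r ≤ s := by
      by_contra hcon
      have h2 := h.cross_pos (φ := ψ) (ψ := 0 + 2 * Real.pi) (by linarith [hψ.2])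
        (by linarith [hψ.1])
      have h3 := hA ψ
      have e1 : A - Γ ψ = ((r - s : ℝ) : ℂ) * dir β := by
        push_cast; linear_combination hAr - hψs
      have e2 : Γ 0 - Γ ψ = ((-s : ℝ) : ℂ) * dir β := by
        push_cast; linear_combination -hψs
      rw [h.periodic, e2, cross_mul_right] at h2
      rw [e1, cross_mul_right] at h3
      nlinarith
    have hA2 : A = (1 - r / s) • Γ 0 + (r / s) • Γ ψ := by
      have hs' : (s : ℂ) ≠ 0 := by exact_mod_cast hs.ne'
      simp only [Complex.real_smul]
      push_cast
      field_simp
      linear_combination s * hAr - r * hψs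
    rw [hA2]
    exact convex_convexHull ℝ _ (hmem 0) (hmem ψ)
      (by rw [sub_nonneg, div_le_one hs]; exact hrs) (by positivity) (by ring)

lemma dir_eq_of_eq (h : IsAngleParam Γ R M) (he : Γ ψ = Γ φ) : dir ψ = dir φ := by
  obtain ⟨χ, h1, h2, h3, h4⟩ := h.exists_shift φ ψ
  rcases h1.eq_or_lt with h1 | h1
  · rw [← h4, h1]
  · have := h.cross_pos h1 h2
    rw [h3, he, sub_self] at this
    simp [cross] at this

/-- The positive tangent segment from a point is unique. -/
lemma eq_of_positive_tangent (h : IsAngleParam Γ R M) {d' : ℝ} (hd : 0 < d) (hd' : 0 < d')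
    (h1 : A = Γ φ - d * dir φ) (h2 : A = Γ ψ - d' * dir ψ) : Γ φ = Γ ψ := by
  by_contra hne
  have h3 := h.cross_pos_of_ne hne
  have h4 := h.cross_pos_of_ne (Ne.symm hne)
  have e1 : Γ φ - Γ ψ = d * dir φ - d' * dir ψ := by linear_combination h2 - h1
  have e2 : Γ ψ - Γ φ = d' * dir ψ - d * dir φ := by linear_combination h1 - h2
  rw [e1, cross_sub_right, cross_mul_right, cross_mul_right, cross_self, cross_dir_dir] at h3
  rw [e2, cross_sub_right, cross_mul_right, cross_mul_right, cross_self, cross_dir_dir] at h4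
  have h5 : 0 < Real.sin (φ - ψ) :=
    pos_of_mul_pos_right (by linarith : 0 < d * Real.sin (φ - ψ)) hd.le
  rw [← neg_sub φ ψ, Real.sin_neg] at h4
  nlinarith

/-- The negative tangent segment from a point is unique. -/
lemma eq_of_negative_tangent (h : IsAngleParam Γ R M) {e' : ℝ} (he : 0 < e) (he' : 0 < e')
    (h1 : A = Γ φ + e * dir φ) (h2 : A = Γ ψ + e' * dir ψ) : Γ φ = Γ ψ := by
  by_contra hne
  have h3 := h.cross_pos_of_ne hne
  have h4 := h.cross_pos_of_ne (Ne.symm hne)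
  have e1 : Γ φ - Γ ψ = e' * dir ψ - e * dir φ := by linear_combination h2 - h1
  have e2 : Γ ψ - Γ φ = e * dir φ - e' * dir ψ := by linear_combination h1 - h2
  rw [e1, cross_sub_right, cross_mul_right, cross_mul_right, cross_self, cross_dir_dir] at h3
  rw [e2, cross_sub_right, cross_mul_right, cross_mul_right, cross_self, cross_dir_dir] at h4
  rw [← neg_sub ψ φ, Real.sin_neg] at h3
  have h5 : 0 < Real.sin (ψ - φ) :=
    pos_of_mul_pos_right (by linarith : 0 < e * Real.sin (ψ - φ)) he.le
  nlinarith

end IsAngleParam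

namespace TangentPair

variable {Γ : ℝ → ℂ} {R : ℝ → ℝ} {M : ℝ} {φ ψ e d : ℝ} {A : ℂ}

lemma sin_pos (p : TangentPair Γ φ ψ A e d) : 0 < Real.sin (ψ - φ) :=
  Real.sin_pos_of_pos_of_lt_pi (by linarith [p.lt]) (by linarith [p.lt_add_pi])

lemma right_mul_sin (p : TangentPair Γ φ ψ A e d) :
    d * Real.sin (ψ - φ) = cross (dir φ) (Γ ψ - Γ φ) := by
  have : Γ ψ - Γ φ = e * dir φ + d * dir ψ := by linear_combination p.eq_left - p.eq_right
  rw [this, cross_add_right, cross_mul_right, cross_mul_right, cross_self, cross_dir_dir]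
  ring

lemma left_mul_sin (p : TangentPair Γ φ ψ A e d) :
    e * Real.sin (ψ - φ) = cross (dir ψ) (Γ φ - Γ ψ) := by
  have : Γ φ - Γ ψ = -(e * dir φ + d * dir ψ) := by linear_combination p.eq_right - p.eq_left
  have h2 : cross (dir ψ) (Γ φ - Γ ψ) = -cross (dir ψ) (e * dir φ + d * dir ψ) := by
    rw [this]; simp [cross]; ring
  rw [h2, cross_add_right, cross_mul_right, cross_mul_right, cross_self, cross_dir_dir,
    ← neg_sub ψ φ, Real.sin_neg]
  ring

lemma right_pos (p : TangentPair Γ φ ψ A e d) (h : IsAngleParam Γ R M) : 0 < d := by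
  have h1 := h.cross_pos p.lt (by linarith [p.lt_add_pi, Real.pi_pos])
  rw [← p.right_mul_sin] at h1
  exact pos_of_mul_pos_left h1 p.sin_pos.le

lemma left_pos (p : TangentPair Γ φ ψ A e d) (h : IsAngleParam Γ R M) : 0 < e := by
  have h1 := h.cross_pos (φ := ψ) (ψ := φ + 2 * Real.pi) (by linarith [p.lt_add_pi, Real.pi_pos])
    (by linarith [p.lt])
  rw [h.periodic, ← p.left_mul_sin] at h1
  exact pos_of_mul_pos_left h1 p.sin_pos.le

lemma notMem_table (p : TangentPair Γ φ ψ A e d) (h : IsAngleParam Γ R M) : A ∉ table Γ := by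
  intro hA
  rw [h.mem_table_iff] at hA
  have h1 := h.eq_of_cross_eq_zero (φ := φ) hA (by
    rw [p.eq_left, add_sub_cancel_left, cross_mul_right, cross_self, mul_zero])
  have h2 := p.eq_left
  rw [h1, left_eq_add] at h2
  simp [dir_ne_zero, (p.left_pos h).ne'] at h2

lemma of_cross_eq_zero (h1 : φ < ψ) (h2 : ψ < φ + Real.pi)
    (h3 : cross (dir φ) (A - Γ φ) = 0) (h4 : cross (dir ψ) (A - Γ ψ) = 0) :
    TangentPair Γ φ ψ A (dot (dir φ) (A - Γ φ)) (-dot (dir ψ) (A - Γ ψ)) := by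
  refine ⟨h1, h2, eq_add_of_cross_eq_zero h3, ?_⟩
  rw [Complex.ofReal_neg, neg_mul, sub_neg_eq_add]
  exact eq_add_of_cross_eq_zero h4

lemma exists_of_angles (Γ : ℝ → ℂ) (h1 : φ < ψ) (h2 : ψ < φ + Real.pi) :
    ∃ A e d, TangentPair Γ φ ψ A e d := by
  have hs : Real.sin (ψ - φ) ≠ 0 :=
    (Real.sin_pos_of_pos_of_lt_pi (by linarith) (by linarith)).ne'
  refine ⟨Γ φ + (cross (dir ψ) (Γ φ - Γ ψ) / Real.sin (ψ - φ) : ℝ) * dir φ, _, _,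
    TangentPair.of_cross_eq_zero h1 h2 ?_ ?_⟩
  · rw [add_sub_cancel_left, cross_mul_right, cross_self, mul_zero]
  · rw [add_sub_right_comm, cross_add_right, cross_mul_right, cross_dir_dir, ← neg_sub ψ φ,
      Real.sin_neg]
    field_simp
    ring

lemma eq_of_angles {A' : ℂ} {e' d' : ℝ} (p : TangentPair Γ φ ψ A e d)
    (p' : TangentPair Γ φ ψ A' e' d') : A = A' := by
  have := mul_right_cancel₀ p.sin_pos.ne' (p.left_mul_sin.trans p'.left_mul_sin.symm)
  rw [p.eq_left, p'.eq_left, this]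

end TangentPair

namespace IsAngleParam

variable {Γ : ℝ → ℂ} {R : ℝ → ℝ} {M : ℝ} {φ ψ e d : ℝ} {A : ℂ}

/-- There are a positive and a negative tangent segment from each point of the exterior: the signed
distance of the point to the tangent line at `Γ s` changes sign twice in a period. -/
lemma exists_tangentPair (h : IsAngleParam Γ R M) (hA : A ∉ table Γ) :
    ∃ φ ψ e d, TangentPair Γ φ ψ A e d := by
  rw [h.mem_table_iff] at hA
  push Not at hA
  obtain ⟨χ, hχ⟩ := hA
  have hπ := Real.pi_pos
  set g : ℝ → ℝ := fun s => cross (dir s) (A - Γ s) with hg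
  have hgc : Continuous g := continuous_iff_continuousAt.2 fun s =>
    ((hasDerivAt_dir s).cross ((hasDerivAt_const s A).sub (h.hasDerivAt s))).continuousAt
  have hsum (s : ℝ) : g s + g (s + Real.pi) = breadth Γ s := by
    simp only [hg, breadth, dir_add_pi]; simp [cross]; ring
  obtain ⟨ψ, hψ, hψ0⟩ : 0 ∈ g '' Set.Ioo χ (χ + Real.pi) :=
    intermediate_value_Ioo (by linarith) hgc.continuousOn
      ⟨hχ, by linarith [hsum χ, h.breadth_pos χ, show g χ < 0 from hχ]⟩
  obtain ⟨φ, hφ, hφ0⟩ : 0 ∈ g '' Set.Ioo (χ - Real.pi) χ :=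
    intermediate_value_Ioo' (by linarith) hgc.continuousOn
      ⟨hχ, by
        have := hsum (χ - Real.pi)
        rw [sub_add_cancel] at this
        linarith [h.breadth_pos (χ - Real.pi), show g χ < 0 from hχ]⟩
  have key (s : ℝ) (hs : g s = 0) : cross (dir χ) (Γ s - Γ χ)
      + dot (dir s) (A - Γ s) * Real.sin (s - χ) < 0 := by
    have := hχ
    rwa [eq_add_of_cross_eq_zero hs, add_sub_right_comm, cross_add_right, cross_mul_right,
      cross_dir_dir] at this
  have hψ1 : dot (dir ψ) (A - Γ ψ) < 0 := by
    have h1 := key ψ hψ0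
    have h2 := h.cross_nonneg χ ψ
    have h3 : 0 < Real.sin (ψ - χ) :=
      Real.sin_pos_of_pos_of_lt_pi (by linarith [hψ.1]) (by linarith [hψ.2])
    nlinarith
  have hφ1 : 0 < dot (dir φ) (A - Γ φ) := by
    have h1 := key φ hφ0
    have h2 := h.cross_nonneg χ φ
    have h3 : Real.sin (φ - χ) < 0 :=
      Real.sin_neg_of_neg_of_neg_pi_lt (by linarith [hφ.2]) (by linarith [hφ.1])
    nlinarith
  have hlt : φ < ψ := hφ.2.trans hψ.1
  refine ⟨φ, ψ, _, _, TangentPair.of_cross_eq_zero hlt ?_ hφ0 hψ0⟩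
  have h1 := h.cross_pos hlt (by linarith [hφ.1, hψ.2])
  have e1 : Γ ψ - Γ φ = dot (dir φ) (A - Γ φ) * dir φ - dot (dir ψ) (A - Γ ψ) * dir ψ := by
    linear_combination eq_add_of_cross_eq_zero hφ0 - eq_add_of_cross_eq_zero hψ0
  rw [e1, cross_sub_right, cross_mul_right, cross_mul_right, cross_self, cross_dir_dir] at h1
  by_contra hcon
  have h2 : Real.sin (ψ - φ) ≤ 0 := by
    rw [← neg_nonneg, ← Real.sin_sub_pi]
    exact Real.sin_nonneg_of_nonneg_of_le_pi (by linarith) (by linarith [hφ.1, hψ.2])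
  nlinarith

/-- A circle that touches the curve from outside at `Γ φ` and a tangent line of the curve at another point are
tangent to each other only if the circle and the curve are on the same side of the line. -/
lemma abs_cross_eq_iff (h : IsAngleParam Γ R M) {ρ : ℝ} (hρ : 0 < ρ) (hne : Γ ψ ≠ Γ φ) :
    |cross (dir ψ) (Γ φ - ρ * (I * dir φ) - Γ ψ)| = ρ ↔
      cross (dir ψ) (Γ φ - Γ ψ) = ρ * (1 + Real.cos (ψ - φ)) := by
  have h1 := h.cross_pos_of_ne hne.symm
  have e1 : cross (dir ψ) (Γ φ - ρ * (I * dir φ) - Γ ψ)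
      = cross (dir ψ) (Γ φ - Γ ψ) - ρ * Real.cos (ψ - φ) := by
    rw [sub_right_comm, cross_sub_right, cross_mul_right, cross_dir_I_mul_dir, ← neg_sub ψ φ,
      Real.cos_neg]
  rw [e1, abs_eq hρ.le]
  constructor
  · rintro (h2 | h2)
    · linarith
    · nlinarith [Real.cos_le_one (ψ - φ)]
  · intro h2
    left; linarith

/-- Two common tangent lines at `Γ ψ` and `Γ χ` of the curve and of a circle that touches the curve from outside
at `Γ φ`. The number `s` is the coordinate of `Γ ψ` on its tangent line, measured from the
tangency point of the circle. -/
lemma exists_coordinate (h : IsAngleParam Γ R M) {ρ χ : ℝ}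
    (hne : Γ ψ ≠ Γ φ) (hψ : cross (dir ψ) (Γ φ - Γ ψ) = ρ * (1 + Real.cos (ψ - φ)))
    (hχ : cross (dir χ) (Γ φ - Γ χ) = ρ * (1 + Real.cos (χ - φ))) :
    ∃ s, ρ * (1 + Real.cos (ψ - φ)) < s * Real.sin (ψ - φ) ∧
      s * Real.sin (χ - ψ) ≤ ρ * (1 - Real.cos (χ - ψ)) := by
  set c : ℂ := Γ φ - ρ * (I * dir φ) with hc
  have e1 (t : ℝ) : cross (dir t) (c - Γ t)
      = cross (dir t) (Γ φ - Γ t) - ρ * Real.cos (t - φ) := by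
    rw [hc, sub_right_comm, cross_sub_right, cross_mul_right, cross_dir_I_mul_dir, ← neg_sub t φ,
      Real.cos_neg]
  have hψ1 := e1 ψ
  have hχ1 := e1 χ
  rw [hψ] at hψ1
  rw [hχ] at hχ1
  have e2 : Γ ψ - c = dot (dir ψ) (Γ ψ - c) * dir ψ - ρ * (I * dir ψ) := by
    have := eq_dot_cross ψ (Γ ψ - c)
    have h2 : cross (dir ψ) (Γ ψ - c) = -ρ := by
      rw [cross_sub_swap, cross_swap, hψ1]; ring
    rw [h2] at this
    push_cast at this
    linear_combination this
  refine ⟨dot (dir ψ) (Γ ψ - c), ?_, ?_⟩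
  · have h3 := h.cross_pos_of_ne hne
    have e3 : Γ ψ - Γ φ = (Γ ψ - c) - ρ * (I * dir φ) := by rw [hc]; ring
    rw [e3, e2] at h3
    simp only [cross_sub_right, cross_mul_right, cross_dir_I_mul_dir, cross_dir_dir, sub_self,
      Real.cos_zero] at h3
    linarith
  · have h3 := h.cross_nonneg χ ψ
    have e3 : Γ ψ - Γ χ = (Γ ψ - c) + (c - Γ χ) := by ring
    rw [e3, cross_add_right, hχ1, e2] at h3
    simp only [cross_sub_right, cross_mul_right, cross_dir_I_mul_dir, cross_dir_dir] at h3
    rw [← neg_sub χ ψ, Real.sin_neg, Real.cos_neg] at h3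
    linarith

/-- The curve and a circle that touches it from outside at `Γ φ` have at most one common tangent line at a
point `Γ ψ` with `ψ ∈ (φ, φ + π)`. -/
lemma common_tangent_unique (h : IsAngleParam Γ R M) {ρ χ : ℝ} (hρ : 0 < ρ)
    (h1 : φ < ψ) (h2 : ψ < φ + Real.pi) (h3 : φ < χ) (h4 : χ < φ + Real.pi)
    (hψ : cross (dir ψ) (Γ φ - Γ ψ) = ρ * (1 + Real.cos (ψ - φ)))
    (hχ : cross (dir χ) (Γ φ - Γ χ) = ρ * (1 + Real.cos (χ - φ))) : ψ = χ := by
  wlog hlt : ψ < χ generalizing ψ χ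
  · rcases (not_lt.1 hlt).eq_or_lt with h5 | h5
    · exact h5.symm
    · exact (this h3 h4 h1 h2 hχ hψ h5).symm
  exfalso
  have hne : Γ ψ ≠ Γ φ := by
    intro h0
    have := h.cross_pos h1 (by linarith [Real.pi_pos])
    rw [h0, sub_self] at this
    simp [cross] at this
  obtain ⟨s, hs1, hs2⟩ := h.exists_coordinate hne hψ hχ
  have hδ : 0 < Real.sin (ψ - φ) := Real.sin_pos_of_pos_of_lt_pi (by linarith) (by linarith)
  have hη : 0 < Real.sin (χ - ψ) := Real.sin_pos_of_pos_of_lt_pi (by linarith) (by linarith)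
  have h5 := sin_add_sin_add_sub_sin (ψ - φ) (χ - ψ)
  have h6 : 0 < 4 * Real.cos ((ψ - φ + (χ - ψ)) / 2) * Real.sin ((χ - ψ) / 2)
      * Real.cos ((ψ - φ) / 2) := by
    have c1 : 0 < Real.cos ((ψ - φ + (χ - ψ)) / 2) :=
      Real.cos_pos_of_mem_Ioo ⟨by linarith [Real.pi_pos], by linarith⟩
    have c2 : 0 < Real.sin ((χ - ψ) / 2) :=
      Real.sin_pos_of_pos_of_lt_pi (by linarith) (by linarith)
    have c3 : 0 < Real.cos ((ψ - φ) / 2) :=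
      Real.cos_pos_of_mem_Ioo ⟨by linarith [Real.pi_pos], by linarith⟩
    positivity
  rw [← h5, Real.sin_add] at h6
  have h7 := mul_lt_mul_of_pos_right hs1 hη
  have h8 := mul_le_mul_of_nonneg_right hs2 hδ.le
  nlinarith [mul_pos hρ h6]

/-- The curve and a circle that touches it from outside at `Γ φ` have at most one common tangent line at a
point `Γ ψ` with `ψ ∈ (φ - π, φ)`. -/
lemma common_tangent_unique' (h : IsAngleParam Γ R M) {ρ χ : ℝ} (hρ : 0 < ρ)
    (h1 : ψ < φ) (h2 : φ < ψ + Real.pi) (h3 : χ < φ) (h4 : φ < χ + Real.pi)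
    (hψ : cross (dir ψ) (Γ φ - Γ ψ) = ρ * (1 + Real.cos (ψ - φ)))
    (hχ : cross (dir χ) (Γ φ - Γ χ) = ρ * (1 + Real.cos (χ - φ))) : ψ = χ := by
  wlog hlt : χ < ψ generalizing ψ χ
  · rcases (not_lt.1 hlt).eq_or_lt with h5 | h5
    · exact h5
    · exact (this h3 h4 h1 h2 hχ hψ h5).symm
  exfalso
  have hne : Γ ψ ≠ Γ φ := by
    intro h0
    have := h.cross_pos h1 (by linarith [Real.pi_pos])
    rw [h0, sub_self] at this
    simp [cross] at this
  obtain ⟨s, hs1, hs2⟩ := h.exists_coordinate hne hψ hχ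
  have hδ : Real.sin (ψ - φ) < 0 :=
    Real.sin_neg_of_neg_of_neg_pi_lt (by linarith) (by linarith)
  have hη : Real.sin (χ - ψ) < 0 :=
    Real.sin_neg_of_neg_of_neg_pi_lt (by linarith) (by linarith)
  have h5 := sin_add_sin_add_sub_sin (ψ - φ) (χ - ψ)
  have h6 : 4 * Real.cos ((ψ - φ + (χ - ψ)) / 2) * Real.sin ((χ - ψ) / 2)
      * Real.cos ((ψ - φ) / 2) < 0 := by
    have c1 : 0 < Real.cos ((ψ - φ + (χ - ψ)) / 2) :=
      Real.cos_pos_of_mem_Ioo ⟨by linarith [Real.pi_pos], by linarith⟩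
    have c2 : Real.sin ((χ - ψ) / 2) < 0 :=
      Real.sin_neg_of_neg_of_neg_pi_lt (by linarith) (by linarith)
    have c3 : 0 < Real.cos ((ψ - φ) / 2) :=
      Real.cos_pos_of_mem_Ioo ⟨by linarith [Real.pi_pos], by linarith⟩
    have : 0 < 4 * Real.cos ((ψ - φ + (χ - ψ)) / 2) * -Real.sin ((χ - ψ) / 2)
      * Real.cos ((ψ - φ) / 2) := by
      have := neg_pos.2 c2
      positivity
    linarith
  rw [← h5, Real.sin_add] at h6
  have h7 := mul_lt_mul_of_neg_right hs1 hη
  have h8 := mul_le_mul_of_nonpos_right hs2 hδ.le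
  nlinarith [mul_pos hρ (neg_pos.2 h6)]

/-- Existence of the common tangent line in `common_tangent_unique`. -/
lemma exists_common_tangent (h : IsAngleParam Γ R M) {ρ : ℝ} (hρ : 0 < ρ) (φ : ℝ) :
    ∃ ψ, φ < ψ ∧ ψ < φ + Real.pi ∧
      cross (dir ψ) (Γ φ - Γ ψ) = ρ * (1 + Real.cos (ψ - φ)) := by
  set g : ℝ → ℝ := fun s => cross (dir s) (Γ φ - Γ s) - ρ * (1 + Real.cos (s - φ)) with hg
  have hgc : Continuous g := by
    refine Continuous.sub (continuous_iff_continuousAt.2 fun s =>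
      ((hasDerivAt_dir s).cross
        ((hasDerivAt_const s (Γ φ)).sub (h.hasDerivAt s))).continuousAt) (by fun_prop)
  obtain ⟨ψ, hψ, hψ0⟩ : 0 ∈ g '' Set.Ioo φ (φ + Real.pi) := by
    refine intermediate_value_Ioo (by linarith [Real.pi_pos]) hgc.continuousOn ⟨?_, ?_⟩
    · simp only [hg, sub_self, Real.cos_zero]
      simp [cross]; linarith
    · have := h.breadth_pos φ
      simp only [hg, add_sub_cancel_left, Real.cos_pi, dir_add_pi]
      simp only [breadth, cross, Complex.sub_re, Complex.sub_im, Complex.neg_re,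
        Complex.neg_im] at this ⊢
      linarith
  exact ⟨ψ, hψ.1, hψ.2, sub_eq_zero.1 hψ0⟩

end IsAngleParam

/-- The third tangent line of the construction of the map is at the angle `φ₂`: a circle of some radius `ρ`
touches the curve from outside at the point with the angle `φ₁` and is tangent to the tangent lines with the
angles `φ₀` and `φ₂`. Here `d` and `e` are the distances from the touching point to the intersection points of
these two lines with the common tangent line. Each equation says that the distance is `ρ tan (θ / 2)`,
where `θ` is the angle under which the curve is seen from the intersection point. -/
def SameCircle (φ₀ φ₁ φ₂ d e : ℝ) : Prop :=
  ∃ ρ, 0 < ρ ∧ d * Real.sin (φ₁ - φ₀) = ρ * (1 + Real.cos (φ₁ - φ₀)) ∧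
    e * Real.sin (φ₂ - φ₁) = ρ * (1 + Real.cos (φ₂ - φ₁))

section Image

variable {γ Γ : ℝ → ℂ} {R θ : ℝ → ℝ} {M T φ₀ φ₁ e₀ d₁ : ℝ} {A : ℂ}

lemma TangentPair.one_add_cos_pos (p : TangentPair Γ φ₀ φ₁ A e₀ d₁) :
    0 < 1 + Real.cos (φ₁ - φ₀) := by
  have h1 := p.sin_pos
  have h2 := Real.sin_sq_add_cos_sq (φ₁ - φ₀)
  nlinarith [Real.neg_one_le_cos (φ₁ - φ₀)]

lemma IsAngleParam.exists_sameCircle (h : IsAngleParam Γ R M)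
    (p : TangentPair Γ φ₀ φ₁ A e₀ d₁) :
    ∃ φ₂ B e₁ d₂, TangentPair Γ φ₁ φ₂ B e₁ d₂ ∧ SameCircle φ₀ φ₁ φ₂ d₁ e₁ := by
  have hc := p.one_add_cos_pos
  have hρ : 0 < d₁ * Real.sin (φ₁ - φ₀) / (1 + Real.cos (φ₁ - φ₀)) :=
    div_pos (mul_pos (p.right_pos h) p.sin_pos) hc
  obtain ⟨φ₂, h1, h2, h3⟩ := h.exists_common_tangent hρ φ₁
  obtain ⟨B, e₁, d₂, q⟩ := TangentPair.exists_of_angles Γ h1 h2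
  refine ⟨φ₂, B, e₁, d₂, q, _, hρ, ?_, ?_⟩
  · field_simp
  · rw [q.left_mul_sin, h3]

lemma IsAngleParam.eq_of_sameCircle (h : IsAngleParam Γ R M) {φ₂ φ₂' e₁ e₁' d₂ d₂' : ℝ} {B B' : ℂ}
    (p : TangentPair Γ φ₀ φ₁ A e₀ d₁)
    (q : TangentPair Γ φ₁ φ₂ B e₁ d₂) (q' : TangentPair Γ φ₁ φ₂' B' e₁' d₂')
    (hq : SameCircle φ₀ φ₁ φ₂ d₁ e₁) (hq' : SameCircle φ₀ φ₁ φ₂' d₁ e₁') : B = B' := by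
  obtain ⟨ρ, hρ, h1, h2⟩ := hq
  obtain ⟨ρ', -, h1', h2'⟩ := hq'
  obtain rfl : ρ = ρ' := mul_right_cancel₀ p.one_add_cos_pos.ne' (h1.symm.trans h1')
  rw [q.left_mul_sin] at h2
  rw [q'.left_mul_sin] at h2'
  obtain rfl := h.common_tangent_unique hρ q.lt q.lt_add_pi q'.lt q'.lt_add_pi h2 h2'
  exact q.eq_of_angles q'

/-- The relation between a point and its image in terms of the angles of the tangent lines. -/
theorem isImage_iff (hγ : IsOval γ T) (h : IsAngleParam Γ R M) (hθ : Function.Surjective θ)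
    (hγΓ : ∀ t, γ t = Γ (θ t)) (hγ' : ∀ t, deriv γ t = ‖deriv γ t‖ * dir (θ t))
    (p : TangentPair Γ φ₀ φ₁ A e₀ d₁) (B : ℂ) :
    IsImage γ A B ↔ ∃ φ₂ e₁ d₂, TangentPair Γ φ₁ φ₂ B e₁ d₂ ∧ SameCircle φ₀ φ₁ φ₂ d₁ e₁ := by
  have hn (t : ℝ) : 0 < ‖deriv γ t‖ := norm_pos_iff.2 (hγ.deriv_ne_zero t)
  have hn' (t : ℝ) : (‖deriv γ t‖ : ℂ) ≠ 0 := by exact_mod_cast (hn t).ne'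
  have hunit (t : ℝ) : deriv γ t / ‖deriv γ t‖ = dir (θ t) := by
    rw [div_eq_iff (hn' t), mul_comm]; exact hγ' t
  have htan (t : ℝ) (q c : ℂ) (ρ : ℝ) :
      LineTangentToCircle q (deriv γ t) c ρ ↔ |cross (dir (θ t)) (c - q)| = ρ := by
    unfold LineTangentToCircle
    nth_rewrite 1 [hγ' t]
    rw [cross_mul_left, abs_mul, abs_of_pos (hn t), mul_comm, mul_left_inj' (hn t).ne']
  have hline (t : ℝ) (z : ℂ) : cross (deriv γ t) z = 0 ↔ cross (dir (θ t)) z = 0 := by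
    rw [hγ' t, cross_mul_left, mul_eq_zero, or_iff_right (hn t).ne']
  -- the circle touches the line through `A` and `Γ φ₀` iff its radius is the expected one
  have hx (ρ : ℝ) (hρ : 0 < ρ) : |cross (dir φ₀) (Γ φ₁ - ρ * (I * dir φ₁) - A)| = ρ ↔
      d₁ * Real.sin (φ₁ - φ₀) = ρ * (1 + Real.cos (φ₁ - φ₀)) := by
    have hne : Γ φ₀ ≠ Γ φ₁ := by
      intro h0
      have := h.cross_pos p.lt (by linarith [p.lt_add_pi, Real.pi_pos])
      rw [h0, sub_self] at this
      simp [cross] at this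
    rw [p.right_mul_sin, ← neg_sub φ₀ φ₁, Real.cos_neg, ← h.abs_cross_eq_iff hρ hne, p.eq_left,
      ← sub_sub, cross_sub_right _ _ (e₀ * dir φ₀), cross_mul_right, cross_self, mul_zero, sub_zero]
  constructor
  · rintro ⟨x, x', x'', a, a', ρ, c, ha', h1, ha, h2, hρ, hc, h3, hne, hne', h4, h5, h6⟩
    rw [hγΓ] at h1 h2
    have e1 : Γ (θ x') = Γ φ₁ := by
      refine h.eq_of_positive_tangent (mul_pos ha' (hn x')) (p.right_pos h) (A := A) ?_ p.eq_right
      rw [h1]; nth_rewrite 1 [hγ' x']; push_cast; ring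
    have e0 : Γ (θ x) = Γ φ₀ := by
      refine h.eq_of_negative_tangent (mul_pos ha (hn x)) (p.left_pos h) (A := A) ?_ p.eq_left
      rw [h2]; nth_rewrite 1 [hγ' x]; push_cast; ring
    have e1' := h.dir_eq_of_eq e1
    have e0' := h.dir_eq_of_eq e0
    rw [hunit, e1', hγΓ, e1] at hc
    rw [htan, e0', hc, hx ρ hρ] at h3
    rw [hγΓ, hγΓ x, e0] at hne
    rw [hγΓ, hγΓ x', e1] at hne'
    rw [htan, hγΓ] at h4
    rw [hline, hγΓ, e1, e1'] at h5
    rw [hline, hγΓ] at h6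
    obtain ⟨φ₂, l1, l2, l3, l4⟩ := h.exists_shift (φ₁ - Real.pi) (θ x'')
    rw [← l3] at hne hne' h4 h6
    rw [← l4] at h4 h6
    rw [hc, h.abs_cross_eq_iff hρ hne'] at h4
    have hgt : φ₁ < φ₂ := by
      rcases lt_trichotomy φ₂ φ₁ with l5 | l5 | l5
      · exfalso
        rcases l1.eq_or_lt with l6 | l6
        · have h7 := h.cross_pos_of_ne hne'.symm
          rw [h4, ← l6, sub_sub_cancel_left, Real.cos_neg, Real.cos_pi] at h7
          simp at h7
        · rw [p.right_mul_sin, ← neg_sub φ₀ φ₁, Real.cos_neg] at h3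
          have := h.common_tangent_unique' hρ l5 (by linarith) p.lt p.lt_add_pi h4 h3
          exact hne (by rw [this])
      · exact absurd (by rw [l5]) hne'
      · exact l5
    have q := TangentPair.of_cross_eq_zero hgt (by linarith) h5 h6
    refine ⟨φ₂, _, _, q, ρ, hρ, h3, ?_⟩
    rw [q.left_mul_sin, h4]
  · rintro ⟨φ₂, e₁, d₂, q, ρ, hρ, h3, h4⟩
    obtain ⟨x, rfl⟩ := hθ φ₀
    obtain ⟨x', rfl⟩ := hθ φ₁
    obtain ⟨x'', rfl⟩ := hθ φ₂
    have hne {s t : ℝ} (h1 : s < t) (h2 : t < s + 2 * Real.pi) : Γ t ≠ Γ s := by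
      intro h0
      have := h.cross_pos h1 h2
      rw [h0, sub_self] at this
      simp [cross] at this
    have hne1 := hne q.lt (by linarith [q.lt_add_pi, Real.pi_pos])
    refine ⟨x, x', x'', e₀ / ‖deriv γ x‖, d₁ / ‖deriv γ x'‖, ρ,
      γ x' - ρ * (I * (deriv γ x' / ‖deriv γ x'‖)), div_pos (p.right_pos h) (hn x'), ?_,
      div_pos (p.left_pos h) (hn x), ?_, hρ, rfl, ?_, ?_, ?_, ?_, ?_, ?_⟩
    · push_cast
      rw [div_mul_eq_mul_div, mul_div_assoc, hunit, hγΓ, p.eq_right]; ring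
    · push_cast
      rw [div_mul_eq_mul_div, mul_div_assoc, hunit, hγΓ, p.eq_left]; ring
    · rw [htan, hunit, hγΓ, hx ρ hρ, h3]
    · rw [hγΓ, hγΓ x]
      exact hne (p.lt.trans q.lt) (by linarith [q.lt_add_pi, p.lt_add_pi])
    · rwa [hγΓ, hγΓ x']
    · rw [htan, hunit, hγΓ, hγΓ x'', h.abs_cross_eq_iff hρ hne1, ← q.left_mul_sin, h4]
    · rw [hline, hγΓ, q.eq_left, add_sub_cancel_left, cross_mul_right, cross_self, mul_zero]
    · rw [hline, hγΓ, q.eq_right, sub_sub_cancel_left, ← neg_mul, ← Complex.ofReal_neg,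
        cross_mul_right, cross_self, mul_zero]

end Image

/-! ### The time-1 flow -/

section Flow

variable {γ Γ : ℝ → ℂ} {R : ℝ → ℝ} {M : ℝ} {O p q : ℂ}

lemma IsAngleParam.width_eq (h : IsAngleParam Γ R M) (hγ : Set.range γ = Set.range Γ) (α : ℝ) :
    width γ α = breadth Γ α := by
  have hmem (s : ℝ) : ∃ t, γ t = Γ s := by
    have : Γ s ∈ Set.range γ := hγ ▸ ⟨s, rfl⟩
    exact this
  have hmem' (t : ℝ) : ∃ s, Γ s = γ t := by
    have : γ t ∈ Set.range Γ := hγ ▸ ⟨t, rfl⟩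
    exact this
  have hub (t : ℝ) : cross (dir α) (γ t) ≤ cross (dir α) (Γ (α + Real.pi)) := by
    obtain ⟨s, hs⟩ := hmem' t
    have := h.cross_nonneg (α + Real.pi) s
    rw [dir_add_pi] at this
    rw [← hs]
    simp only [cross, Complex.neg_re, Complex.neg_im, Complex.sub_re, Complex.sub_im] at this ⊢
    linarith
  have hlb (t : ℝ) : cross (dir α) (Γ α) ≤ cross (dir α) (γ t) := by
    obtain ⟨s, hs⟩ := hmem' t
    have := h.cross_nonneg α s
    rw [cross_sub_right] at this
    rw [← hs]
    linarith
  have h1 : ⨆ t, cross (dir α) (γ t) = cross (dir α) (Γ (α + Real.pi)) := by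
    obtain ⟨t, ht⟩ := hmem (α + Real.pi)
    refine le_antisymm (ciSup_le hub) ?_
    rw [← ht]
    exact le_ciSup (f := fun t => cross (dir α) (γ t)) ⟨_, by rintro _ ⟨t, rfl⟩; exact hub t⟩ t
  have h2 : ⨅ t, cross (dir α) (γ t) = cross (dir α) (Γ α) := by
    obtain ⟨t, ht⟩ := hmem α
    refine le_antisymm ?_ (le_ciInf hlb)
    rw [← ht]
    exact ciInf_le (f := fun t => cross (dir α) (γ t)) ⟨_, by rintro _ ⟨t, rfl⟩; exact hlb t⟩ t
  change (⨆ t, cross (dir α) (γ t)) - (⨅ t, cross (dir α) (γ t)) = _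
  rw [h1, h2, breadth, cross_sub_right]

/-- The value of the vector field `field γ O` at the points of the ray from `O` in the direction `dir α`. -/
noncomputable def fieldDir (Γ : ℝ → ℂ) (α : ℝ) : ℂ := ((-(2 * breadth Γ α) : ℝ) : ℂ) * (I * dir α)

lemma IsAngleParam.norm_fieldDir_le (h : IsAngleParam Γ R M) (α : ℝ) :
    ‖fieldDir Γ α‖ ≤ 4 * Real.pi * M := by
  rw [fieldDir, norm_mul, norm_mul, Complex.norm_I, norm_dir, Complex.norm_real, Real.norm_eq_abs,
    abs_neg, abs_mul, abs_two]
  linarith [h.abs_breadth_le α]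

lemma IsAngleParam.norm_fieldDir_sub_le (h : IsAngleParam Γ R M) (α β : ℝ) :
    ‖fieldDir Γ α - fieldDir Γ β‖ ≤ 8 * Real.pi * M * ‖dir α - dir β‖ := by
  have e : fieldDir Γ α - fieldDir Γ β
      = ((-(2 * (breadth Γ α - breadth Γ β)) : ℝ) : ℂ) * (I * dir α)
        + ((-(2 * breadth Γ β) : ℝ) : ℂ) * (I * (dir α - dir β)) := by
    simp only [fieldDir]; push_cast; ring
  rw [e]
  refine (norm_add_le _ _).trans ?_
  simp only [norm_mul, Complex.norm_I, norm_dir, Complex.norm_real, Real.norm_eq_abs, abs_neg,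
    abs_mul, abs_two, one_mul, mul_one]
  have h1 := h.abs_breadth_sub_le α β
  have h2 := mul_le_mul_of_nonneg_right (h.abs_breadth_le β) (norm_nonneg (dir α - dir β))
  linarith

lemma IsAngleParam.field_eq (h : IsAngleParam Γ R M) (hw : ∀ α, width γ α = breadth Γ α)
    {r α : ℝ} (hr : 0 < r) (hp : p - O = r * dir α) : field γ O p = fieldDir Γ α := by
  have hn : ‖p - O‖ = r := by rw [hp]; simp [hr.le]
  have hdir : dir (p - O).arg = dir α := by
    have h1 := dir_arg (p - O)
    rw [hn, hp] at h1
    rw [hp]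
    exact mul_left_cancel₀ (by exact_mod_cast hr.ne') h1
  have hb : breadth Γ (p - O).arg = breadth Γ α := by
    have := h.abs_breadth_sub_le (p - O).arg α
    rw [hdir, sub_self, norm_zero, mul_zero] at this
    exact sub_eq_zero.1 (abs_nonpos_iff.1 this)
  have hr' : (r : ℂ) ≠ 0 := by exact_mod_cast hr.ne'
  rw [field, hw, hb, hn, hp, fieldDir]
  push_cast
  field_simp

lemma IsAngleParam.field_eq_arg (h : IsAngleParam Γ R M) (hw : ∀ α, width γ α = breadth Γ α)
    (hp : p ≠ O) : field γ O p = fieldDir Γ (p - O).arg :=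
  h.field_eq hw (norm_pos_iff.2 (sub_ne_zero.2 hp)) (dir_arg _).symm

/-- The vector field is Lipschitz on the circles with center `O`. -/
lemma IsAngleParam.norm_field_sub_le (h : IsAngleParam Γ R M) (hw : ∀ α, width γ α = breadth Γ α)
    {r : ℝ} (hr : 0 < r) (hp : ‖p - O‖ = r) (hq : ‖q - O‖ = r) :
    ‖field γ O p - field γ O q‖ ≤ 8 * Real.pi * M / r * ‖p - q‖ := by
  have h1 := dir_arg (p - O)
  have h2 := dir_arg (q - O)
  rw [hp] at h1
  rw [hq] at h2
  rw [h.field_eq hw hr h1.symm, h.field_eq hw hr h2.symm]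
  have e : p - q = r * (dir (p - O).arg - dir (q - O).arg) := by
    rw [mul_sub, h1, h2]; ring
  refine (h.norm_fieldDir_sub_le _ _).trans (le_of_eq ?_)
  rw [e, norm_mul, Complex.norm_real, Real.norm_of_nonneg hr.le]
  field_simp

/-- The orbits are contained in circles with center `O`. -/
lemma norm_sub_eq_of_flow {f : ℝ → ℂ}
    (hf : ∀ t ∈ Set.Icc (0 : ℝ) 1, f t ≠ O ∧ HasDerivWithinAt f (field γ O (f t)) (Set.Icc 0 1) t)
    {t : ℝ} (ht : t ∈ Set.Icc (0 : ℝ) 1) : ‖f t - O‖ = ‖f 0 - O‖ := by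
  have hd (s : ℝ) (hs : s ∈ Set.Icc (0 : ℝ) 1) :
      HasDerivWithinAt (fun s => ‖f s - O‖ ^ 2) 0 (Set.Icc 0 1) s := by
    refine ((((hf s hs).2.sub_const O).norm_sq)).congr_deriv ?_
    simp [field, Complex.inner]
    ring
  have := Convex.norm_image_sub_le_of_norm_hasDerivWithin_le (C := 0) hd (by simp)
    (convex_Icc 0 1) (Set.left_mem_Icc.2 zero_le_one) ht
  rw [zero_mul, norm_le_zero_iff, sub_eq_zero] at this
  exact (sq_eq_sq₀ (norm_nonneg _) (norm_nonneg _)).1 this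

lemma IsAngleParam.isTimeOneFlow_unique (h : IsAngleParam Γ R M)
    (hw : ∀ α, width γ α = breadth Γ α) {q' : ℂ} (hp : p ≠ O)
    (hq : IsTimeOneFlow γ O p q) (hq' : IsTimeOneFlow γ O p q') : q = q' := by
  obtain ⟨f, hf0, rfl, hf⟩ := hq
  obtain ⟨g, hg0, rfl, hg⟩ := hq'
  have hr : 0 < ‖p - O‖ := norm_pos_iff.2 (sub_ne_zero.2 hp)
  have hK : 0 ≤ 8 * Real.pi * M / ‖p - O‖ := by
    have := h.bound_pos
    have := Real.pi_pos
    positivity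
  have hIci {f : ℝ → ℂ} {f' : ℂ} {t : ℝ} (ht : t ∈ Set.Ico (0 : ℝ) 1)
      (hf : HasDerivWithinAt f f' (Set.Icc 0 1) t) : HasDerivWithinAt f f' (Set.Ici t) t :=
    hf.mono_of_mem_nhdsWithin (Icc_mem_nhdsGE_of_mem ht)
  refine ODE_solution_unique_of_mem_Icc_right (v := fun _ => field γ O)
    (s := fun _ => {z | ‖z - O‖ = ‖p - O‖}) (K := ⟨_, hK⟩) (a := 0) (b := 1) ?_
    (fun t ht => (hf t ht).2.continuousWithinAt)
    (fun t ht => hIci ht (hf t (Set.Ico_subset_Icc_self ht)).2) ?_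
    (fun t ht => (hg t ht).2.continuousWithinAt)
    (fun t ht => hIci ht (hg t (Set.Ico_subset_Icc_self ht)).2) ?_ (hf0.trans hg0.symm)
    (Set.right_mem_Icc.2 zero_le_one)
  · intro t _
    refine LipschitzOnWith.of_dist_le_mul fun x hx y hy => ?_
    rw [dist_eq_norm, dist_eq_norm]
    exact h.norm_field_sub_le hw hr hx hy
  · intro t ht
    rw [Set.mem_ofPred_eq, norm_sub_eq_of_flow hf (Set.Ico_subset_Icc_self ht), hf0]
  · intro t ht
    rw [Set.mem_ofPred_eq, norm_sub_eq_of_flow hg (Set.Ico_subset_Icc_self ht), hg0]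

/-- The time-1 flow exists: in polar coordinates it is a bounded Lipschitz differential equation for the
angle. -/
lemma IsAngleParam.exists_isTimeOneFlow (h : IsAngleParam Γ R M)
    (hw : ∀ α, width γ α = breadth Γ α) (hp : p ≠ O) : ∃ q, IsTimeOneFlow γ O p q := by
  set r := ‖p - O‖ with hr_def
  have hr : 0 < r := norm_pos_iff.2 (sub_ne_zero.2 hp)
  have hM := h.bound_pos
  have hπ := Real.pi_pos
  have hL0 : 0 ≤ 2 / r * (2 * Real.pi * M) := by positivity
  have hlip (x y : ℝ) : |-(2 / r * breadth Γ x) - -(2 / r * breadth Γ y)|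
      ≤ 2 / r * (2 * Real.pi * M) * |x - y| := by
    have e : -(2 / r * breadth Γ x) - -(2 / r * breadth Γ y)
        = -(2 / r * (breadth Γ x - breadth Γ y)) := by ring
    rw [e, abs_neg, abs_mul, abs_of_pos (by positivity : 0 < 2 / r), mul_assoc]
    refine mul_le_mul_of_nonneg_left ((h.abs_breadth_sub_le x y).trans ?_) (by positivity)
    exact mul_le_mul_of_nonneg_left (norm_dir_sub_le y x) (by positivity)
  have hpl : IsPicardLindelof (fun _ x => -(2 / r * breadth Γ x)) (tmin := 0) (tmax := 1)
      ⟨0, by simp⟩ (p - O).arg ⟨_, hL0⟩ 0 ⟨_, hL0⟩ ⟨_, hL0⟩ := by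
    refine IsPicardLindelof.of_time_independent (fun x _ => ?_) ?_ ?_
    · change |_| ≤ 2 / r * (2 * Real.pi * M)
      rw [abs_neg, abs_mul, abs_of_pos (by positivity : 0 < 2 / r)]
      exact mul_le_mul_of_nonneg_left (h.abs_breadth_le x) (by positivity)
    · refine LipschitzOnWith.of_dist_le_mul fun x _ y _ => ?_
      exact hlip x y
    · simp
  obtain ⟨α, hα0, hα⟩ := hpl.exists_eq_forall_mem_Icc_hasDerivWithinAt₀
  refine ⟨O + r * dir (α 1), fun t => O + r * dir (α t), ?_, rfl, fun t ht => ⟨?_, ?_⟩⟩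
  · change O + r * dir (α 0) = p
    have : α 0 = (p - O).arg := hα0
    rw [this, dir_arg]; ring
  · simp [hr.ne', dir_ne_zero]
  · rw [h.field_eq hw hr (α := α t) (by ring)]
    have hr' : (r : ℂ) ≠ 0 := by exact_mod_cast hr.ne'
    refine ((((hasDerivAt_dir (α t)).scomp_hasDerivWithinAt t (hα t ht)).const_mul
      (r : ℂ)).const_add O).congr_deriv ?_
    rw [fieldDir, Complex.real_smul]
    push_cast
    field_simp

lemma IsAngleParam.isTimeOneFlow_iff (h : IsAngleParam Γ R M)
    (hw : ∀ α, width γ α = breadth Γ α) (hp : p ≠ O) (q : ℂ) :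
    IsTimeOneFlow γ O p q ↔ q = timeOneFlow γ O p := by
  have hspec : IsTimeOneFlow γ O p (timeOneFlow γ O p) :=
    Classical.epsilon_spec (h.exists_isTimeOneFlow hw hp)
  exact ⟨fun hq => h.isTimeOneFlow_unique hw hp hq hspec, fun hq => hq ▸ hspec⟩

/-- The time-1 flow is a translation by the vector field up to an error of order `1 / ‖p - O‖`. -/
lemma IsAngleParam.norm_timeOneFlow_sub_le (h : IsAngleParam Γ R M)
    (hw : ∀ α, width γ α = breadth Γ α) (hp : p ≠ O) :
    ‖timeOneFlow γ O p - p - fieldDir Γ (p - O).arg‖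
      ≤ 8 * Real.pi * M * (4 * Real.pi * M) / ‖p - O‖ := by
  obtain ⟨f, hf0, hf1, hf⟩ := (h.isTimeOneFlow_iff hw hp _).2 rfl
  have hr : 0 < ‖p - O‖ := norm_pos_iff.2 (sub_ne_zero.2 hp)
  have hM := h.bound_pos
  have hπ := Real.pi_pos
  have hmem0 : (0 : ℝ) ∈ Set.Icc (0 : ℝ) 1 := Set.left_mem_Icc.2 zero_le_one
  have hmem1 : (1 : ℝ) ∈ Set.Icc (0 : ℝ) 1 := Set.right_mem_Icc.2 zero_le_one
  have hstay (t : ℝ) (ht : t ∈ Set.Icc (0 : ℝ) 1) : ‖f t - p‖ ≤ 4 * Real.pi * M := by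
    have := Convex.norm_image_sub_le_of_norm_hasDerivWithin_le (C := 4 * Real.pi * M)
      (fun s hs => (hf s hs).2)
      (fun s hs => by rw [h.field_eq_arg hw (hf s hs).1]; exact h.norm_fieldDir_le _)
      (convex_Icc 0 1) hmem0 ht
    rw [hf0, sub_zero, Real.norm_of_nonneg ht.1] at this
    exact this.trans (mul_le_of_le_one_right (by positivity) ht.2)
  have := Convex.norm_image_sub_le_of_norm_hasDerivWithin_le
    (C := 8 * Real.pi * M / ‖p - O‖ * (4 * Real.pi * M))
    (f := fun t => f t - t • field γ O p)
    (fun s hs => (hf s hs).2.sub ((hasDerivWithinAt_id s _).smul_const (field γ O p)))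
    (fun s hs => by
      rw [one_smul]
      refine (h.norm_field_sub_le hw hr ?_ rfl).trans ?_
      · rw [norm_sub_eq_of_flow hf hs, hf0]
      · exact mul_le_mul_of_nonneg_left (hstay s hs) (by positivity))
    (convex_Icc 0 1) hmem0 hmem1
  rw [one_smul, zero_smul, sub_zero, sub_zero, norm_one, mul_one, hf0, hf1] at this
  rw [← h.field_eq_arg hw hp]
  calc _ = ‖timeOneFlow γ O p - field γ O p - p‖ := by congr 1; ring
    _ ≤ _ := this
    _ = _ := by ring

lemma IsAngleParam.norm_timeOneFlow_sub_center (h : IsAngleParam Γ R M)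
    (hw : ∀ α, width γ α = breadth Γ α) (hp : p ≠ O) : ‖timeOneFlow γ O p - O‖ = ‖p - O‖ := by
  obtain ⟨f, hf0, hf1, hf⟩ := (h.isTimeOneFlow_iff hw hp _).2 rfl
  rw [← hf1, ← hf0]
  exact norm_sub_eq_of_flow hf (Set.right_mem_Icc.2 zero_le_one)

end Flow

/-! ### Bounds for tangent segments -/

namespace TangentPair

variable {Γ : ℝ → ℂ} {R : ℝ → ℝ} {M : ℝ} {φ ψ e d : ℝ} {A : ℂ}

/-- The angle between the tangent segments. -/
lemma angle_pos (p : TangentPair Γ φ ψ A e d) : 0 < φ + Real.pi - ψ := by linarith [p.lt_add_pi]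

lemma angle_lt_pi (p : TangentPair Γ φ ψ A e d) : φ + Real.pi - ψ < Real.pi := by linarith [p.lt]

lemma sin_sub_eq (φ ψ : ℝ) : Real.sin (ψ - φ) = Real.sin (φ + Real.pi - ψ) := by
  rw [← Real.sin_pi_sub]; congr 1; ring

lemma cos_sub_eq (φ ψ : ℝ) : Real.cos (ψ - φ) = -Real.cos (φ + Real.pi - ψ) := by
  rw [← Real.cos_pi_sub]; congr 1; ring

/-- A tangent segment is long only if it is seen under a small angle. -/
lemma mul_angle_le_of_mul_sin_eq (h : IsAngleParam Γ R M) {x D θ δ N : ℝ} (hx : x * Real.sin δ = N)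
    (hx0 : 0 ≤ x) (h1 : N ≤ 2 * Real.pi * M) (h2 : N ≤ M * δ) (hθ0 : 0 < θ) (hδ0 : 0 < δ)
    (hsum : θ + δ = Real.pi) (hD : D = Real.pi ^ 2 * M) : x * θ ≤ D := by
  have hπ := Real.pi_pos
  have hM := h.bound_pos
  rcases le_total θ (Real.pi / 2) with h3 | h3
  · have h4 := Real.mul_le_sin hθ0.le h3
    have h5 : Real.sin δ = Real.sin θ := by rw [← Real.sin_pi_sub]; congr 1; linarith
    rw [h5] at hx
    have h6 := mul_le_mul_of_nonneg_left h4 hx0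
    have h7 : x * (2 / Real.pi * θ) = x * θ * 2 / Real.pi := by ring
    rw [h7, hx, div_le_iff₀ hπ] at h6
    rw [hD]
    nlinarith
  · have h4 := Real.mul_le_sin hδ0.le (by linarith)
    have h6 := mul_le_mul_of_nonneg_left h4 hx0
    have h7 : x * (2 / Real.pi * δ) = (x * 2 / Real.pi) * δ := by ring
    rw [h7, hx] at h6
    have h8 := le_of_mul_le_mul_right (h6.trans h2) hδ0
    rw [div_le_iff₀ hπ] at h8
    have h9 : x * θ ≤ x * Real.pi := mul_le_mul_of_nonneg_left (by linarith) hx0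
    rw [hD]
    nlinarith [mul_pos hM (mul_pos hπ hπ)]

lemma right_mul_angle_le (p : TangentPair Γ φ ψ A e d) (h : IsAngleParam Γ R M) :
    d * (φ + Real.pi - ψ) ≤ Real.pi ^ 2 * M := by
  refine mul_angle_le_of_mul_sin_eq h p.right_mul_sin (p.right_pos h).le ?_ ?_ p.angle_pos
    (sub_pos.2 p.lt) (by ring) rfl
  · exact (le_abs_self _).trans ((abs_cross_dir_le _ _).trans (h.norm_sub_le_diam _ _))
  · refine (le_abs_self _).trans ((abs_cross_dir_le _ _).trans ((h.norm_sub_le _ _).trans ?_))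
    rw [abs_of_pos (sub_pos.2 p.lt)]

lemma left_mul_angle_le (p : TangentPair Γ φ ψ A e d) (h : IsAngleParam Γ R M) :
    e * (φ + Real.pi - ψ) ≤ Real.pi ^ 2 * M := by
  refine mul_angle_le_of_mul_sin_eq h p.left_mul_sin (p.left_pos h).le ?_ ?_ p.angle_pos
    (sub_pos.2 p.lt) (by ring) rfl
  · exact (le_abs_self _).trans ((abs_cross_dir_le _ _).trans (h.norm_sub_le_diam _ _))
  · refine (le_abs_self _).trans ((abs_cross_dir_le _ _).trans ((h.norm_sub_le _ _).trans ?_))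
    rw [abs_sub_comm, abs_of_pos (sub_pos.2 p.lt)]

lemma abs_right_mul_sin_sub_le (p : TangentPair Γ φ ψ A e d) (h : IsAngleParam Γ R M) :
    |d * Real.sin (φ + Real.pi - ψ) - breadth Γ φ| ≤ M * (φ + Real.pi - ψ) ^ 2 := by
  rw [← sin_sub_eq, p.right_mul_sin, breadth, ← cross_sub_right, sub_sub_sub_cancel_right]
  refine (h.abs_cross_sub_opposite_le φ ψ).trans (le_of_eq ?_)
  ring

lemma abs_left_mul_sin_sub_le (p : TangentPair Γ φ ψ A e d) (h : IsAngleParam Γ R M) :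
    |e * Real.sin (φ + Real.pi - ψ) - breadth Γ ψ| ≤ M * (φ + Real.pi - ψ) ^ 2 := by
  rw [← sin_sub_eq, p.left_mul_sin, breadth, ← cross_sub_right, sub_sub_sub_cancel_right,
    ← h.periodic φ]
  refine (h.abs_cross_sub_opposite_le ψ (φ + 2 * Real.pi)).trans (le_of_eq ?_)
  ring

lemma breadth_le_of_abs_mul_sin_sub_le (h : IsAngleParam Γ R M) {x θ w : ℝ} (hx : 0 ≤ x) (h0 : 0 < θ)
    (h1 : θ < Real.pi) (hw : |x * Real.sin θ - w| ≤ M * θ ^ 2) : w ≤ (x + Real.pi * M) * θ := by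
  have h2 := Real.sin_le h0.le
  have h3 := (abs_le.1 hw).1
  have h4 := mul_le_mul_of_nonneg_left h2 hx
  have h5 : M * θ ^ 2 ≤ M * (Real.pi * θ) := by
    refine mul_le_mul_of_nonneg_left ?_ h.bound_pos.le
    nlinarith
  nlinarith

/-- The curve is seen from a point at a bounded distance under an angle bounded from below. -/
lemma breadth_le_right (p : TangentPair Γ φ ψ A e d) (h : IsAngleParam Γ R M) :
    breadth Γ φ ≤ (d + Real.pi * M) * (φ + Real.pi - ψ) :=
  breadth_le_of_abs_mul_sin_sub_le h (p.right_pos h).le p.angle_pos p.angle_lt_pi (p.abs_right_mul_sin_sub_le h)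

lemma breadth_le_left (p : TangentPair Γ φ ψ A e d) (h : IsAngleParam Γ R M) :
    breadth Γ ψ ≤ (e + Real.pi * M) * (φ + Real.pi - ψ) :=
  breadth_le_of_abs_mul_sin_sub_le h (p.left_pos h).le p.angle_pos p.angle_lt_pi (p.abs_left_mul_sin_sub_le h)

/-- The difference of the lengths of the tangent segments from a distant point. -/
lemma abs_left_sub_right_add_le (p : TangentPair Γ φ ψ A e d) (h : IsAngleParam Γ R M) :
    |e - d + breadthDeriv Γ φ| ≤ (Real.pi ^ 2 * M + M) * (φ + Real.pi - ψ) := by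
  set θ := φ + Real.pi - ψ with hθ
  have hM := h.bound_pos
  have h0 : 0 < θ := p.angle_pos
  have e1 : Γ ψ - Γ φ = e * dir φ + d * dir ψ := by linear_combination p.eq_left - p.eq_right
  have e2 : dot (dir φ) (Γ ψ - Γ φ) = e - d * Real.cos θ := by
    rw [e1, dot_add_right, dot_mul_right, dot_mul_right, dot_dir_dir, dot_dir_dir, sub_self,
      Real.cos_zero, cos_sub_eq φ ψ]
    ring
  have e3 : e - d + breadthDeriv Γ φ
      = dot (dir φ) (Γ ψ - Γ (φ + Real.pi)) - d * (1 - Real.cos θ) := by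
    have : dot (dir φ) (Γ ψ - Γ (φ + Real.pi))
        = dot (dir φ) (Γ ψ - Γ φ) - dot (dir φ) (Γ (φ + Real.pi) - Γ φ) := by
      rw [← dot_sub_right, sub_sub_sub_cancel_right]
    rw [this, e2, breadthDeriv]; ring
  have h1 : |dot (dir φ) (Γ ψ - Γ (φ + Real.pi))| ≤ M * θ := by
    refine (abs_dot_dir_le _ _).trans ((h.norm_sub_le _ _).trans (le_of_eq ?_))
    rw [abs_sub_comm, abs_of_pos h0]
  have h2 : |d * (1 - Real.cos θ)| ≤ Real.pi ^ 2 * M * θ := by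
    have h3 := Real.one_sub_sq_div_two_le_cos (x := θ)
    have h4 := Real.cos_le_one θ
    have h5 := p.right_mul_angle_le h
    have h6 := (p.right_pos h).le
    rw [abs_of_nonneg (mul_nonneg h6 (by linarith))]
    calc d * (1 - Real.cos θ) ≤ d * (θ * θ) := mul_le_mul_of_nonneg_left (by nlinarith) h6
      _ = d * θ * θ := by ring
      _ ≤ _ := mul_le_mul_of_nonneg_right h5 h0.le
  rw [e3]
  refine (abs_sub _ _).trans ?_
  linarith

lemma norm_sub_left (p : TangentPair Γ φ ψ A e d) (h : IsAngleParam Γ R M) : ‖A - Γ φ‖ = e := by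
  rw [p.eq_left, add_sub_cancel_left, norm_mul, norm_dir, mul_one, Complex.norm_real,
    Real.norm_of_nonneg (p.left_pos h).le]

lemma norm_sub_right (p : TangentPair Γ φ ψ A e d) (h : IsAngleParam Γ R M) : ‖A - Γ ψ‖ = d := by
  rw [p.eq_right, sub_sub_cancel_left, norm_neg, norm_mul, norm_dir, mul_one, Complex.norm_real,
    Real.norm_of_nonneg (p.right_pos h).le]

lemma abs_left_sub_right_le (p : TangentPair Γ φ ψ A e d) (h : IsAngleParam Γ R M) :
    |e - d| ≤ 2 * Real.pi * M := by
  rw [← p.norm_sub_left h, ← p.norm_sub_right h]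
  refine (abs_norm_sub_norm_le _ _).trans ?_
  rw [sub_sub_sub_cancel_left]
  exact h.norm_sub_le_diam _ _

end TangentPair

section Step

variable {Γ : ℝ → ℂ} {R : ℝ → ℝ} {M : ℝ} {φ₀ φ₁ φ₂ e₀ d₁ e₁ d₂ : ℝ} {A B : ℂ}

lemma sin_eq_tan_half_mul {θ : ℝ} (h0 : 0 < θ) (h1 : θ < Real.pi) :
    Real.sin θ = Real.tan (θ / 2) * (1 + Real.cos θ) ∧
    1 - Real.cos θ = Real.tan (θ / 2) * Real.sin θ := by
  have hc : Real.cos (θ / 2) ≠ 0 := (Real.cos_pos_of_mem_Ioo ⟨by linarith, by linarith⟩).ne'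
  have e1 : Real.sin θ = 2 * Real.sin (θ / 2) * Real.cos (θ / 2) := by
    rw [← Real.sin_two_mul]; congr 1; ring
  have e2 : Real.cos θ = 2 * Real.cos (θ / 2) ^ 2 - 1 := by
    rw [← Real.cos_two_mul]; congr 1; ring
  have e3 := Real.sin_sq_add_cos_sq (θ / 2)
  rw [e1, e2, Real.tan_eq_sin_div_cos]
  constructor
  · field_simp; ring
  · field_simp; linear_combination -2 * e3

lemma half_le_tan_half {θ : ℝ} (h0 : 0 < θ) (h1 : θ < Real.pi) : θ / 2 ≤ Real.tan (θ / 2) :=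
  Real.le_tan (by linarith) (by linarith)

lemma tan_half_le_sin {θ : ℝ} (h0 : 0 < θ) (h1 : θ ≤ Real.pi / 2) :
    Real.tan (θ / 2) ≤ Real.sin θ := by
  have hπ := Real.pi_pos
  have h2 := (sin_eq_tan_half_mul h0 (by linarith)).1
  have h3 := half_le_tan_half h0 (by linarith)
  have h4 := Real.cos_nonneg_of_mem_Icc (x := θ) ⟨by linarith, h1⟩
  nlinarith

/-- The two tangent segments to the circle in `SameCircle` in terms of its radius. -/
lemma SameCircle.exists_radius (p : TangentPair Γ φ₀ φ₁ A e₀ d₁) (q : TangentPair Γ φ₁ φ₂ B e₁ d₂)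
    (hs : SameCircle φ₀ φ₁ φ₂ d₁ e₁) :
    ∃ ρ, 0 < ρ ∧ d₁ = ρ * Real.tan ((φ₀ + Real.pi - φ₁) / 2) ∧
      e₁ = ρ * Real.tan ((φ₁ + Real.pi - φ₂) / 2) := by
  obtain ⟨ρ, hρ, h1, h2⟩ := hs
  refine ⟨ρ, hρ, ?_, ?_⟩
  · refine mul_right_cancel₀ p.sin_pos.ne' ?_
    rw [h1, TangentPair.sin_sub_eq, TangentPair.cos_sub_eq, ← sub_eq_add_neg,
      (sin_eq_tan_half_mul p.angle_pos p.angle_lt_pi).2]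
    ring
  · refine mul_right_cancel₀ q.sin_pos.ne' ?_
    rw [h2, TangentPair.sin_sub_eq, TangentPair.cos_sub_eq, ← sub_eq_add_neg,
      (sin_eq_tan_half_mul q.angle_pos q.angle_lt_pi).2]
    ring

/-- A bounded part of the exterior has a bounded image. -/
lemma SameCircle.exists_le (h : IsAngleParam Γ R M) (D : ℝ) :
    ∃ E, ∀ φ₀ φ₁ φ₂ e₀ d₁ e₁ d₂ A B, TangentPair Γ φ₀ φ₁ A e₀ d₁ → TangentPair Γ φ₁ φ₂ B e₁ d₂ →
      SameCircle φ₀ φ₁ φ₂ d₁ e₁ → d₁ ≤ D → e₁ ≤ E := by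
  obtain ⟨c, hc, hcw⟩ := h.exists_le_breadth
  have hM := h.bound_pos
  have hπ := Real.pi_pos
  refine ⟨2 * D * (D + Real.pi * M) / c + 2 * Real.pi * M,
    fun φ₀ φ₁ φ₂ e₀ d₁ e₁ d₂ A B p q hs hd => ?_⟩
  obtain ⟨ρ, hρ, h1, h2⟩ := hs.exists_radius p q
  have hd0 := p.right_pos h
  have hD : 0 < D := hd0.trans_le hd
  have hρD : ρ ≤ 2 * D * (D + Real.pi * M) / c := by
    have h3 := (hcw φ₀).trans (p.breadth_le_right h)
    have h4 := half_le_tan_half p.angle_pos p.angle_lt_pi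
    have h5 := p.angle_pos
    set θ := φ₀ + Real.pi - φ₁
    have h6 : ρ * (θ / 2) ≤ D := (mul_le_mul_of_nonneg_left h4 hρ.le).trans (h1 ▸ hd)
    have h7 : c ≤ (D + Real.pi * M) * θ := h3.trans (by gcongr)
    rw [le_div_iff₀ hc]
    have h8 : ρ * c ≤ ρ * ((D + Real.pi * M) * θ) := mul_le_mul_of_nonneg_left h7 hρ.le
    have h9 : 0 < D + Real.pi * M := by positivity
    nlinarith [mul_le_mul_of_nonneg_left h6 h9.le]
  have h5 := q.angle_pos
  have h6 := q.left_mul_angle_le h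
  have he := (q.left_pos h).le
  rcases le_total (φ₁ + Real.pi - φ₂) (Real.pi / 2) with h7 | h7
  · have h8 := (tan_half_le_sin h5 h7).trans (Real.sin_le_one _)
    have h9 := mul_le_mul_of_nonneg_left h8 hρ.le
    have : 0 < 2 * Real.pi * M := by positivity
    linarith
  · have h8 := (mul_le_mul_of_nonneg_left h7 he).trans h6
    have h9 : e₁ ≤ 2 * Real.pi * M := by
      by_contra hcon
      nlinarith
    have : 0 ≤ 2 * D * (D + Real.pi * M) / c := by positivity
    linarith

/-- A point far away has its image far away. -/
lemma SameCircle.exists_le_mul (h : IsAngleParam Γ R M) :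
    ∃ K, 0 < K ∧ ∀ φ₀ φ₁ φ₂ e₀ d₁ e₁ d₂ A B, TangentPair Γ φ₀ φ₁ A e₀ d₁ →
      TangentPair Γ φ₁ φ₂ B e₁ d₂ → SameCircle φ₀ φ₁ φ₂ d₁ e₁ → d₁ ≤ K * (e₁ + Real.pi * M) := by
  obtain ⟨c, hc, hcw⟩ := h.exists_le_breadth
  have hM := h.bound_pos
  have hπ := Real.pi_pos
  set K := 2 + 2 * (Real.pi ^ 2 * M) / c with hK
  have hfrac : 0 < 2 * (Real.pi ^ 2 * M) / c := by positivity
  have hKc : 2 * (Real.pi ^ 2 * M) ≤ K ^ 2 * c := by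
    have h1 : 2 * (Real.pi ^ 2 * M) = 2 * (Real.pi ^ 2 * M) / c * c := by field_simp
    rw [h1]
    refine mul_le_mul_of_nonneg_right ?_ hc.le
    nlinarith
  refine ⟨K, by positivity, fun φ₀ φ₁ φ₂ e₀ d₁ e₁ d₂ A B p q hs => ?_⟩
  obtain ⟨ρ, hρ, h1, h2⟩ := hs.exists_radius p q
  have hd := p.right_pos h
  have he := q.left_pos h
  have hE : 0 < e₁ + Real.pi * M := by positivity
  have h3 := p.right_mul_angle_le h
  have h4 := p.angle_pos
  rcases le_total (φ₀ + Real.pi - φ₁) (Real.pi / 2) with h5 | h5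
  · have h6 := (tan_half_le_sin h4 h5).trans (Real.sin_le h4.le)
    have h7 := half_le_tan_half q.angle_pos q.angle_lt_pi
    have h8 := (hcw φ₂).trans (q.breadth_le_left h)
    set t₁ := Real.tan ((φ₀ + Real.pi - φ₁) / 2)
    set t₂ := Real.tan ((φ₁ + Real.pi - φ₂) / 2)
    have h9 : d₁ * t₁ ≤ Real.pi ^ 2 * M := (mul_le_mul_of_nonneg_left h6 hd.le).trans h3
    have h10 : c ≤ 2 * ((e₁ + Real.pi * M) * t₂) := by nlinarith
    have h11 : d₁ * t₂ = e₁ * t₁ := by rw [h1, h2]; ring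
    have h12 : d₁ ^ 2 * c ≤ K ^ 2 * c * (e₁ + Real.pi * M) ^ 2 := by
      calc d₁ ^ 2 * c ≤ d₁ ^ 2 * (2 * ((e₁ + Real.pi * M) * t₂)) :=
            mul_le_mul_of_nonneg_left h10 (by positivity)
        _ = 2 * (d₁ * t₁) * (e₁ * (e₁ + Real.pi * M)) := by
            linear_combination 2 * d₁ * (e₁ + Real.pi * M) * h11
        _ ≤ 2 * (Real.pi ^ 2 * M) * (e₁ * (e₁ + Real.pi * M)) := by gcongr
        _ ≤ K ^ 2 * c * (e₁ * (e₁ + Real.pi * M)) := by gcongr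
        _ ≤ K ^ 2 * c * (e₁ + Real.pi * M) ^ 2 := by
            rw [sq (e₁ + Real.pi * M)]
            gcongr
            linarith [mul_pos hπ hM]
    have h13 : d₁ ^ 2 ≤ (K * (e₁ + Real.pi * M)) ^ 2 := by
      rw [mul_pow]
      nlinarith
    exact (pow_le_pow_iff_left₀ hd.le (by positivity) two_ne_zero).1 h13
  · have h8 := (mul_le_mul_of_nonneg_left h5 hd.le).trans h3
    have h9 : d₁ ≤ 2 * (Real.pi * M) := by
      by_contra hcon
      nlinarith
    have h10 : 2 * (e₁ + Real.pi * M) ≤ K * (e₁ + Real.pi * M) :=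
      mul_le_mul_of_nonneg_right (by linarith) hE.le
    linarith

/-- The equation that determines the angle `φ₂`, in terms of the quantities that approximate the width of the
curve. -/
lemma SameCircle.sq_mul_eq (p : TangentPair Γ φ₀ φ₁ A e₀ d₁) (q : TangentPair Γ φ₁ φ₂ B e₁ d₂)
    (hs : SameCircle φ₀ φ₁ φ₂ d₁ e₁) :
    e₁ ^ 2 * ((1 + Real.cos (φ₁ + Real.pi - φ₂)) * (d₁ * Real.sin (φ₀ + Real.pi - φ₁)))
      = d₁ ^ 2 * ((1 + Real.cos (φ₀ + Real.pi - φ₁)) * (e₁ * Real.sin (φ₁ + Real.pi - φ₂))) := by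
  obtain ⟨ρ, hρ, h1, h2⟩ := hs.exists_radius p q
  rw [(sin_eq_tan_half_mul p.angle_pos p.angle_lt_pi).1,
    (sin_eq_tan_half_mul q.angle_pos q.angle_lt_pi).1]
  set t₁ := Real.tan ((φ₀ + Real.pi - φ₁) / 2)
  set t₂ := Real.tan ((φ₁ + Real.pi - φ₂) / 2)
  rw [h1, h2]; ring

end Step

/-! ### Asymptotics of the billiard map far from the curve -/

lemma abs_sub_sin_le {θ : ℝ} (h0 : 0 < θ) (h1 : θ < Real.pi) : |θ - Real.sin θ| ≤ θ ^ 2 := by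
  rw [abs_of_nonneg (sub_nonneg.2 (Real.sin_le h0.le))]
  rcases le_total θ 1 with h2 | h2
  · have := Real.sin_gt_sub_cube h0
    nlinarith [pow_pos h0 2]
  · have := Real.sin_pos_of_pos_of_lt_pi h0 h1
    nlinarith

section Asymptotics

variable {Γ : ℝ → ℂ} {R : ℝ → ℝ} {M : ℝ} {α : Type*} {l : Filter α}
  {φ₀ φ₁ φ₂ e₀ d₁ e₁ d₂ : α → ℝ} {A B : α → ℂ}

/-- A quantity that dominates `g` linearly tends to infinity at least as fast as `g`. -/
lemma isBigO_inv_of_le {f g : α → ℝ} {K C : ℝ} (hK : 0 < K) (hg : Tendsto g l atTop)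
    (hle : ∀ a, g a ≤ K * (f a + C)) :
    Tendsto f l atTop ∧ (fun a => (f a)⁻¹) =O[l] fun a => (g a)⁻¹ := by
  have hle' (a : α) : g a / K - C ≤ f a := by
    have : g a / K ≤ f a + C := by rw [div_le_iff₀ hK]; linarith [hle a]
    linarith
  refine ⟨tendsto_atTop_mono hle' (tendsto_atTop_add_const_right _ _ (hg.atTop_div_const hK)), ?_⟩
  refine IsBigO.of_bound (2 * K) ?_
  filter_upwards [hg.eventually_ge_atTop (2 * K * C), hg.eventually_gt_atTop 0] with a h1 h2
  have h3 : g a ≤ 2 * K * f a := by linarith [hle a]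
  have h4 : 0 < f a := pos_of_mul_pos_right (h2.trans_le h3) (by positivity)
  rw [Real.norm_of_nonneg (inv_nonneg.2 h4.le), Real.norm_of_nonneg (inv_nonneg.2 h2.le),
    ← div_eq_mul_inv, le_div_iff₀ h2, inv_mul_le_iff₀ h4]
  linarith

lemma isBigO_angle (h : IsAngleParam Γ R M)
    (hp : ∀ a, TangentPair Γ (φ₀ a) (φ₁ a) (A a) (e₀ a) (d₁ a)) :
    (fun a => φ₀ a + Real.pi - φ₁ a) =O[l] fun a => (d₁ a)⁻¹ := by
  refine IsBigO.of_bound (Real.pi ^ 2 * M) (Eventually.of_forall fun a => ?_)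
  have h1 := (hp a).right_pos h
  rw [Real.norm_of_nonneg (hp a).angle_pos.le, Real.norm_of_nonneg (inv_nonneg.2 h1.le),
    ← div_eq_mul_inv, le_div_iff₀ h1, mul_comm]
  exact (hp a).right_mul_angle_le h

lemma tendsto_step (h : IsAngleParam Γ R M)
    (hp : ∀ a, TangentPair Γ (φ₀ a) (φ₁ a) (A a) (e₀ a) (d₁ a))
    (hq : ∀ a, TangentPair Γ (φ₁ a) (φ₂ a) (B a) (e₁ a) (d₂ a))
    (hs : ∀ a, SameCircle (φ₀ a) (φ₁ a) (φ₂ a) (d₁ a) (e₁ a)) (hd : Tendsto d₁ l atTop) :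
    Tendsto d₂ l atTop ∧ (fun a => (d₂ a)⁻¹) =O[l] fun a => (d₁ a)⁻¹ := by
  obtain ⟨K, hK, hle⟩ := SameCircle.exists_le_mul h
  refine isBigO_inv_of_le hK hd (C := 3 * Real.pi * M) fun a =>
    (hle _ _ _ _ _ _ _ _ _ (hp a) (hq a) (hs a)).trans (mul_le_mul_of_nonneg_left ?_ hK.le)
  have := (abs_le.1 ((hq a).abs_left_sub_right_le h)).2
  linarith

lemma isBigO_one_of_abs_le {f : α → ℝ} {C : ℝ} (hf : ∀ a, |f a| ≤ C) :
    f =O[l] fun _ => (1 : ℝ) :=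
  IsBigO.of_bound C (Eventually.of_forall fun a => by simpa using hf a)

lemma isBigO_one_add_cos_mul {g θ' w S : α → ℝ} {L : ℝ} (hS : ∀ a, |S a| ≤ L)
    (hθ' : θ' =O[l] g) (hSw : (fun a => S a - w a) =O[l] fun a => g a ^ 2) :
    (fun a => (1 + Real.cos (θ' a)) * S a - 2 * w a) =O[l] fun a => g a ^ 2 := by
  have h1 : (fun a => (1 - Real.cos (θ' a))) =O[l] fun a => g a ^ 2 := by
    refine (IsBigO.of_bound 1 (Eventually.of_forall fun a => ?_)).trans (hθ'.pow 2)
    have h3 := Real.one_sub_sq_div_two_le_cos (x := θ' a)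
    have h4 := Real.cos_le_one (θ' a)
    rw [Real.norm_of_nonneg (by linarith), Real.norm_of_nonneg (sq_nonneg _)]
    nlinarith [sq_nonneg (θ' a)]
  have h2 := (h1.mul (isBigO_one_of_abs_le (l := l) hS))
  simp only [mul_one] at h2
  refine ((hSw.const_mul_left 2).sub h2).congr_left fun a => ?_
  ring

/-- The asymptotics of the map: the lengths of the tangent segments on the common tangent line of a distant
point and of its image differ by the derivative of the width. -/
lemma isBigO_step (h : IsAngleParam Γ R M)
    (hp : ∀ a, TangentPair Γ (φ₀ a) (φ₁ a) (A a) (e₀ a) (d₁ a))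
    (hq : ∀ a, TangentPair Γ (φ₁ a) (φ₂ a) (B a) (e₁ a) (d₂ a))
    (hs : ∀ a, SameCircle (φ₀ a) (φ₁ a) (φ₂ a) (d₁ a) (e₁ a)) (hd : Tendsto d₁ l atTop) :
    ((fun a => e₁ a - d₁ a) =O[l] fun _ => (1 : ℝ)) ∧
    (fun a => e₁ a - d₁ a + breadthDeriv Γ (φ₁ a)) =O[l] fun a => (d₁ a)⁻¹ := by
  obtain ⟨c, hc, hcw⟩ := h.exists_le_breadth
  have hM := h.bound_pos
  have hπ := Real.pi_pos
  set g : α → ℝ := fun a => (d₁ a)⁻¹ with hg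
  have hdpos (a : α) : 0 < d₁ a := (hp a).right_pos h
  have hepos (a : α) : 0 < e₁ a := (hq a).left_pos h
  have hg0 : Tendsto g l (𝓝 0) := hd.inv_tendsto_atTop
  have hg1 : g =O[l] fun _ => (1 : ℝ) := hg0.isBigO_one ℝ
  have hgg : (fun a => g a ^ 2) =O[l] g := by
    refine ((isBigO_refl g l).mul hg1).congr (fun a => by ring) fun a => by simp
  set θ₁ : α → ℝ := fun a => φ₀ a + Real.pi - φ₁ a with hθ₁
  set θ₂ : α → ℝ := fun a => φ₁ a + Real.pi - φ₂ a with hθ₂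
  set w₀ : α → ℝ := fun a => breadth Γ (φ₀ a) with hw₀
  set w₂ : α → ℝ := fun a => breadth Γ (φ₂ a) with hw₂
  set w' : α → ℝ := fun a => breadthDeriv Γ (φ₀ a) with hw'
  have oθ₁ : θ₁ =O[l] g := isBigO_angle h hp
  have oθ₂ : θ₂ =O[l] g := (isBigO_angle h hq).trans (tendsto_step h hp hq hs hd).2
  have ow' : w' =O[l] fun _ => (1 : ℝ) := isBigO_one_of_abs_le fun a => h.abs_breadthDeriv_le _
  have ow₀ : w₀ =O[l] fun _ => (1 : ℝ) := isBigO_one_of_abs_le fun a => h.abs_breadth_le _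
  -- products with bounded functions
  have hbd {f k u : α → ℝ} (hf : f =O[l] fun _ => (1 : ℝ)) (hk : k =O[l] u) :
      (fun a => f a * k a) =O[l] u := by
    simpa using hf.mul hk
  set S₁ : α → ℝ := fun a => d₁ a * Real.sin (θ₁ a) with hS₁
  set S₂ : α → ℝ := fun a => e₁ a * Real.sin (θ₂ a) with hS₂
  have oS₁ : (fun a => S₁ a - w₀ a) =O[l] fun a => g a ^ 2 := by
    refine (IsBigO.of_bound M (Eventually.of_forall fun a => ?_)).trans (oθ₁.pow 2)
    rw [Real.norm_of_nonneg (sq_nonneg (θ₁ a))]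
    exact (hp a).abs_right_mul_sin_sub_le h
  have oS₂ : (fun a => S₂ a - w₂ a) =O[l] fun a => g a ^ 2 := by
    refine (IsBigO.of_bound M (Eventually.of_forall fun a => ?_)).trans (oθ₂.pow 2)
    rw [Real.norm_of_nonneg (sq_nonneg (θ₂ a))]
    exact (hq a).abs_left_mul_sin_sub_le h
  have bS₁ (a : α) : |S₁ a| ≤ 2 * Real.pi * M := by
    simp only [hS₁, hθ₁]
    rw [← TangentPair.sin_sub_eq, (hp a).right_mul_sin]
    exact (abs_cross_dir_le _ _).trans (h.norm_sub_le_diam _ _)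
  have bS₂ (a : α) : |S₂ a| ≤ 2 * Real.pi * M := by
    simp only [hS₂, hθ₂]
    rw [← TangentPair.sin_sub_eq, (hq a).left_mul_sin]
    exact (abs_cross_dir_le _ _).trans (h.norm_sub_le_diam _ _)
  set X : α → ℝ := fun a => (1 + Real.cos (θ₂ a)) * S₁ a with hX
  set Y : α → ℝ := fun a => (1 + Real.cos (θ₁ a)) * S₂ a with hY
  have oX : (fun a => X a - 2 * w₀ a) =O[l] fun a => g a ^ 2 := isBigO_one_add_cos_mul bS₁ oθ₂ oS₁
  have oY : (fun a => Y a - 2 * w₂ a) =O[l] fun a => g a ^ 2 := isBigO_one_add_cos_mul bS₂ oθ₁ oS₂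
  have oTaylor : (fun a => w₂ a - w₀ a + w' a * (θ₁ a + θ₂ a)) =O[l] fun a => g a ^ 2 := by
    refine (IsBigO.of_bound (2 * Real.pi * M + 2 * M)
      (Eventually.of_forall fun a => ?_)).trans ((oθ₁.add oθ₂).pow 2)
    rw [Real.norm_of_nonneg (sq_nonneg (θ₁ a + θ₂ a)), Real.norm_eq_abs]
    have h1 := h.abs_breadth_taylor_le (φ₀ a) (φ₂ a - Real.pi - Real.pi)
    rw [← h.breadth_add_pi, sub_add_cancel, ← h.breadth_add_pi, sub_add_cancel] at h1
    have e1 : φ₂ a - Real.pi - Real.pi - φ₀ a = -(θ₁ a + θ₂ a) := by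
      simp only [hθ₁, hθ₂]; ring
    rw [e1, neg_sq, mul_neg, sub_neg_eq_add] at h1
    exact h1
  have oYX : (fun a => Y a - X a + 2 * (w' a * (θ₁ a + θ₂ a))) =O[l] fun a => g a ^ 2 := by
    refine ((oY.sub oX).add (oTaylor.const_mul_left 2)).congr_left fun a => ?_
    ring
  have oYX' : (fun a => Y a - X a) =O[l] g := by
    refine ((oYX.trans hgg).sub
      ((hbd ow' (oθ₁.add oθ₂)).const_mul_left 2)).congr_left fun a => ?_
    ring
  have hXc : ∀ᶠ a in l, c ≤ X a := by
    have h1 : Tendsto (fun a => X a - 2 * w₀ a) l (𝓝 0) := oX.trans_tendsto (by simpa using hg0.pow 2)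
    filter_upwards [h1.eventually_const_le (show -c < 0 by linarith)] with a ha
    linarith [hcw (φ₀ a)]
  -- the ratio of the two lengths
  set k : α → ℝ := fun a => e₁ a * g a with hk
  have hkd (a : α) : k a * d₁ a = e₁ a := by
    simp only [hk, hg]; rw [mul_assoc, inv_mul_cancel₀ (hdpos a).ne', mul_one]
  have hkpos (a : α) : 0 < k a := mul_pos (hepos a) (inv_pos.2 (hdpos a))
  have hkeq (a : α) : k a ^ 2 * X a = Y a := by
    have h1 := SameCircle.sq_mul_eq (hp a) (hq a) (hs a)
    refine mul_left_cancel₀ (pow_ne_zero 2 (hdpos a).ne') ?_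
    have h2 : d₁ a ^ 2 * (k a ^ 2 * X a) = e₁ a ^ 2 * X a := by rw [← hkd a]; ring
    rw [h2]
    exact h1
  have ok : (fun a => k a - 1) =O[l] g := by
    refine (IsBigO.of_bound c⁻¹ ?_).trans oYX'
    filter_upwards [hXc] with a ha
    have h1 : (k a - 1) * ((k a + 1) * X a) = Y a - X a := by rw [← hkeq a]; ring
    have h2 : c ≤ (k a + 1) * X a := by nlinarith [hkpos a]
    rw [← h1, norm_mul, Real.norm_of_nonneg (hc.le.trans h2), inv_mul_eq_div, le_div_iff₀ hc]
    exact mul_le_mul_of_nonneg_left h2 (norm_nonneg _)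
  have hdg {f : α → ℝ} {n : ℕ} (hf : f =O[l] fun a => g a ^ (n + 1)) :
      (fun a => d₁ a * f a) =O[l] fun a => g a ^ n := by
    refine ((isBigO_refl d₁ l).mul hf).congr_right fun a => ?_
    simp only [hg]
    have := (hdpos a).ne'
    rw [pow_succ']
    field_simp
  have oed : (fun a => e₁ a - d₁ a) =O[l] fun _ => (1 : ℝ) := by
    refine (hdg (n := 0) (ok.congr_right fun a => by simp)).congr (fun a => ?_) fun a => by simp
    linear_combination hkd a
  have od₁θ₁ : (fun a => d₁ a * θ₁ a - w₀ a) =O[l] g := by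
    have h1 : (fun a => θ₁ a - Real.sin (θ₁ a)) =O[l] fun a => g a ^ 2 := by
      refine (IsBigO.of_bound 1 (Eventually.of_forall fun a => ?_)).trans (oθ₁.pow 2)
      rw [one_mul, Real.norm_of_nonneg (sq_nonneg (θ₁ a))]
      exact abs_sub_sin_le (hp a).angle_pos (hp a).angle_lt_pi
    have h2 := (hdg (n := 1) h1).congr_right (g₂ := g) fun a => pow_one _
    refine (h2.add (oS₁.trans hgg)).congr_left fun a => ?_
    simp only [hS₁]; ring
  have od₁θ₂ : (fun a => d₁ a * θ₂ a - w₀ a) =O[l] g := by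
    have h1 : (fun a => θ₂ a - Real.sin (θ₂ a)) =O[l] fun a => g a ^ 2 := by
      refine (IsBigO.of_bound 1 (Eventually.of_forall fun a => ?_)).trans (oθ₂.pow 2)
      rw [one_mul, Real.norm_of_nonneg (sq_nonneg (θ₂ a))]
      exact abs_sub_sin_le (hq a).angle_pos (hq a).angle_lt_pi
    have h2 := (hdg (n := 1) h1).congr_right (g₂ := g) fun a => pow_one _
    have h3 : (fun a => w₂ a - w₀ a) =O[l] g := by
      refine ((oTaylor.trans hgg).sub (hbd ow' (oθ₁.add oθ₂))).congr_left fun a => ?_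
      ring
    have h4 : (fun a => Real.sin (θ₂ a)) =O[l] g := by
      refine (IsBigO.of_bound 1 (Eventually.of_forall fun a => ?_)).trans oθ₂
      rw [one_mul]
      exact Real.abs_sin_le_abs
    refine (((h2.add (oS₂.trans hgg)).add h3).sub (hbd oed h4)).congr_left fun a => ?_
    simp only [hS₂]; ring
  refine ⟨oed, ?_⟩
  have oz : (fun a => 4 * w₀ a * (e₁ a - d₁ a + w' a)) =O[l] g := by
    have h1 : (fun a => (k a + 1) * X a - 4 * w₀ a) =O[l] g := by
      have hXb : X =O[l] fun _ => (1 : ℝ) := by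
        refine ((oX.trans (hgg.trans hg1)).add (ow₀.const_mul_left 2)).congr_left fun a => ?_
        ring
      refine ((hbd hXb ok).add ((oX.trans hgg).const_mul_left 2)).congr_left fun a => ?_
      ring
    have h2 := (hdg (n := 1) oYX).congr_right (g₂ := g) fun a => pow_one _
    have h3 := (hbd ow' (od₁θ₁.add od₁θ₂)).const_mul_left 2
    refine ((h2.sub h3).sub (hbd oed h1)).congr_left fun a => ?_
    have h4 : (e₁ a - d₁ a) * ((k a + 1) * X a) = d₁ a * (Y a - X a) := by
      rw [← hkeq a, ← hkd a]; ring
    linear_combination -h4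
  have oz' : (fun a => e₁ a - d₁ a + w' a) =O[l] g := by
    refine (IsBigO.of_bound (4 * c)⁻¹ (Eventually.of_forall fun a => ?_)).trans oz
    have h1 : 4 * c ≤ 4 * w₀ a := by linarith [hcw (φ₀ a)]
    rw [norm_mul, Real.norm_of_nonneg (by linarith : 0 ≤ 4 * w₀ a), inv_mul_eq_div,
      le_div_iff₀ (by positivity), mul_comm]
    exact mul_le_mul_of_nonneg_right h1 (norm_nonneg _)
  have ow : (fun a => breadthDeriv Γ (φ₁ a) - w' a) =O[l] g := by
    refine (IsBigO.of_bound (2 * Real.pi * M + 2 * M)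
      (Eventually.of_forall fun a => ?_)).trans oθ₁
    have h1 := h.abs_breadthDeriv_sub_le (φ₀ a) (φ₁ a - Real.pi)
    rw [← h.breadthDeriv_add_pi (φ₁ a - Real.pi), sub_add_cancel] at h1
    have e1 : φ₁ a - Real.pi - φ₀ a = -θ₁ a := by simp only [hθ₁]; ring
    rw [e1, abs_neg] at h1
    exact h1
  refine (oz'.add ow).congr_left fun a => ?_
  ring

end Asymptotics

/-! ### The second iteration of the map and the flow -/

section Asymptotics

variable {Γ : ℝ → ℂ} {R : ℝ → ℝ} {M : ℝ} {α : Type*} {l : Filter α}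
  {φ₀ φ₁ φ₂ φ₃ e₀ d₁ e₁ d₂ e₂ d₃ : α → ℝ} {A B A' : α → ℂ}

/-- The second iteration of the map moves a distant point by `fieldDir Γ (φ₁ + π)`, where `φ₁ + π` is the
direction from the curve to the point, up to an error of the order of the inverse distance. -/
lemma isBigO_two_steps (h : IsAngleParam Γ R M)
    (hp : ∀ a, TangentPair Γ (φ₀ a) (φ₁ a) (A a) (e₀ a) (d₁ a))
    (hq : ∀ a, TangentPair Γ (φ₁ a) (φ₂ a) (B a) (e₁ a) (d₂ a))
    (hr : ∀ a, TangentPair Γ (φ₂ a) (φ₃ a) (A' a) (e₂ a) (d₃ a))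
    (hs : ∀ a, SameCircle (φ₀ a) (φ₁ a) (φ₂ a) (d₁ a) (e₁ a))
    (hs' : ∀ a, SameCircle (φ₁ a) (φ₂ a) (φ₃ a) (d₂ a) (e₂ a)) (hd : Tendsto d₁ l atTop) :
    (fun a => A' a - A a - fieldDir Γ (φ₁ a + Real.pi)) =O[l] fun a => (d₁ a)⁻¹ := by
  have hM := h.bound_pos
  have hπ := Real.pi_pos
  set g : α → ℝ := fun a => (d₁ a)⁻¹ with hg
  obtain ⟨hd₂, og₂⟩ := tendsto_step h hp hq hs hd
  obtain ⟨-, oE₁⟩ := isBigO_step h hp hq hs hd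
  obtain ⟨oed₂, oE₂⟩ := isBigO_step h hq hr hs' hd₂
  set θ : α → ℝ := fun a => φ₁ a + Real.pi - φ₂ a with hθ
  have hθ0 (a : α) : 0 < θ a := (hq a).angle_pos
  have oθ : θ =O[l] g := (isBigO_angle h hq).trans og₂
  have ow : (fun a => breadthDeriv Γ (φ₂ a) - breadthDeriv Γ (φ₁ a)) =O[l] g := by
    refine (IsBigO.of_bound (2 * Real.pi * M + 2 * M)
      (Eventually.of_forall fun a => ?_)).trans oθ
    have h1 := h.abs_breadthDeriv_sub_le (φ₁ a) (φ₂ a - Real.pi)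
    rw [← h.breadthDeriv_add_pi (φ₂ a - Real.pi), sub_add_cancel] at h1
    have e1 : φ₂ a - Real.pi - φ₁ a = -θ a := by simp only [hθ]; ring
    rw [e1, abs_neg] at h1
    exact h1
  have oN : (fun a => e₁ a - d₂ a + breadthDeriv Γ (φ₁ a)) =O[l] g := by
    refine (IsBigO.of_bound (Real.pi ^ 2 * M + M) (Eventually.of_forall fun a => ?_)).trans oθ
    rw [Real.norm_of_nonneg (hθ0 a).le]
    exact (hq a).abs_left_sub_right_add_le h
  have ocos : (fun a => 1 - Real.cos (θ a)) =O[l] g := by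
    refine (IsBigO.of_bound Real.pi (Eventually.of_forall fun a => ?_)).trans oθ
    have h3 := Real.one_sub_sq_div_two_le_cos (x := θ a)
    have h4 := Real.cos_le_one (θ a)
    have h5 : θ a < Real.pi := (hq a).angle_lt_pi
    rw [Real.norm_of_nonneg (by linarith), Real.norm_of_nonneg (hθ0 a).le]
    nlinarith [hθ0 a]
  have odcos : (fun a => d₂ a * (1 - Real.cos (θ a))) =O[l] g := by
    refine (IsBigO.of_bound (Real.pi ^ 2 * M) (Eventually.of_forall fun a => ?_)).trans oθ
    have h3 := Real.one_sub_sq_div_two_le_cos (x := θ a)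
    have h4 := Real.cos_le_one (θ a)
    have h5 : d₂ a * θ a ≤ Real.pi ^ 2 * M := (hq a).right_mul_angle_le h
    have h6 := ((hq a).right_pos h).le
    rw [Real.norm_of_nonneg (mul_nonneg h6 (by linarith)), Real.norm_of_nonneg (hθ0 a).le]
    calc d₂ a * (1 - Real.cos (θ a)) ≤ d₂ a * (θ a * θ a) :=
          mul_le_mul_of_nonneg_left (by nlinarith [hθ0 a]) h6
      _ = d₂ a * θ a * θ a := by ring
      _ ≤ _ := mul_le_mul_of_nonneg_right h5 (hθ0 a).le
  have osin : (fun a => Real.sin (θ a)) =O[l] g := by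
    refine (IsBigO.of_bound 1 (Eventually.of_forall fun a => ?_)).trans oθ
    rw [one_mul]
    exact Real.abs_sin_le_abs
  have odsin : (fun a => d₂ a * Real.sin (θ a) - breadth Γ (φ₁ a)) =O[l] g := by
    refine (IsBigO.of_bound (M * Real.pi) (Eventually.of_forall fun a => ?_)).trans oθ
    rw [Real.norm_of_nonneg (hθ0 a).le]
    refine ((hq a).abs_right_mul_sin_sub_le h).trans ?_
    have h5 : θ a < Real.pi := (hq a).angle_lt_pi
    rw [mul_assoc, sq]
    exact mul_le_mul_of_nonneg_left (mul_le_mul_of_nonneg_right h5.le (hθ0 a).le) hM.le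
  have hbd {f k : α → ℝ} (hf : f =O[l] fun _ => (1 : ℝ)) (hk : k =O[l] g) :
      (fun a => f a * k a) =O[l] g := by
    simpa using hf.mul hk
  -- the components of the displacement along and across the common tangent line of the two points
  have oP : (fun a => d₁ a + e₁ a - (d₂ a + e₂ a) * Real.cos (θ a)) =O[l] g := by
    refine (((((ow.sub oE₁).sub (oE₂.trans og₂)).add (oN.const_mul_left 2)).add
      (odcos.const_mul_left 2)).add (hbd oed₂ ocos)).congr_left fun a => ?_
    ring
  have oQ : (fun a => (d₂ a + e₂ a) * Real.sin (θ a) - 2 * breadth Γ (φ₁ a)) =O[l] g := by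
    refine ((odsin.const_mul_left 2).add (hbd oed₂ osin)).congr_left fun a => ?_
    ring
  refine IsBigO.trans (IsBigO.of_bound 1 (Eventually.of_forall fun a => ?_))
    (oP.norm_left.add oQ.norm_left)
  have hdir : dir (φ₂ a) = -(Real.cos (θ a) * dir (φ₁ a) - Real.sin (θ a) * (I * dir (φ₁ a))) := by
    have e1 : φ₂ a = φ₁ a + Real.pi - θ a := by simp only [hθ]; ring
    rw [e1]
    apply Complex.ext
    · simp [Real.cos_sub, -Complex.ofReal_cos, -Complex.ofReal_sin]; ring
    · simp [Real.sin_sub, -Complex.ofReal_cos, -Complex.ofReal_sin]; ring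
  have hdisp : A' a - A a - fieldDir Γ (φ₁ a + Real.pi)
      = ((d₁ a + e₁ a - (d₂ a + e₂ a) * Real.cos (θ a) : ℝ) : ℂ) * dir (φ₁ a)
        + (((d₂ a + e₂ a) * Real.sin (θ a) - 2 * breadth Γ (φ₁ a) : ℝ) : ℂ)
          * (I * dir (φ₁ a)) := by
    have h1 : A' a - A a = (d₁ a + e₁ a) * dir (φ₁ a) + (d₂ a + e₂ a) * dir (φ₂ a) := by
      linear_combination (hr a).eq_left - (hp a).eq_right + (hq a).eq_left - (hq a).eq_right
    rw [h1, hdir, fieldDir, h.breadth_add_pi, dir_add_pi]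
    push_cast; ring
  rw [hdisp, one_mul, Real.norm_of_nonneg (by positivity)]
  refine (norm_add_le _ _).trans (le_of_eq ?_)
  simp only [norm_mul, Complex.norm_I, norm_dir, Complex.norm_real, mul_one]

end Asymptotics

lemma IsAngleParam.norm_sub_le_of_mem_table {Γ : ℝ → ℂ} {R : ℝ → ℝ} {M : ℝ} {O : ℂ}
    (h : IsAngleParam Γ R M) (hO : O ∈ table Γ) (φ : ℝ) : ‖O - Γ φ‖ ≤ 2 * Real.pi * M := by
  rw [← dist_eq_norm]
  refine convexHull_min ?_ (convex_closedBall (Γ φ) (2 * Real.pi * M)) hO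
  rintro _ ⟨ψ, rfl⟩
  rw [Metric.mem_closedBall, dist_eq_norm]
  exact h.norm_sub_le_diam φ ψ

/-- The directions from two points to a third one differ little if the third point is distant. -/
lemma mul_norm_dir_sub_le {A O P : ℂ} {d φ : ℝ} (hd : 0 ≤ d) (hP : A - P = d * dir φ) :
    ‖A - O‖ * ‖dir φ - dir (A - O).arg‖ ≤ 2 * ‖O - P‖ := by
  have hn : ‖A - P‖ = d := by
    rw [hP, norm_mul, norm_dir, mul_one, Complex.norm_real, Real.norm_of_nonneg hd]
  have e : (‖A - O‖ : ℂ) * (dir φ - dir (A - O).arg)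
      = ((‖A - O‖ - ‖A - P‖ : ℝ) : ℂ) * dir φ + (O - P) := by
    have h1 := dir_arg (A - O)
    rw [hn]; push_cast
    linear_combination -hP - h1
  have h2 : ‖A - O‖ * ‖dir φ - dir (A - O).arg‖
      = ‖(‖A - O‖ : ℂ) * (dir φ - dir (A - O).arg)‖ := by
    rw [norm_mul, Complex.norm_real, norm_norm]
  rw [h2, e]
  refine (norm_add_le _ _).trans ?_
  rw [norm_mul, norm_dir, mul_one, Complex.norm_real, Real.norm_eq_abs]
  have h3 := abs_norm_sub_norm_le (A - O) (A - P)
  rw [sub_sub_sub_cancel_left, norm_sub_rev P O] at h3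
  linarith

/-- The second iteration of the map is close to the time-1 flow, in terms of the angles of the tangent lines. -/
theorem IsAngleParam.exists_norm_sub_timeOneFlow_le {γ Γ : ℝ → ℂ} {R : ℝ → ℝ} {M : ℝ}
    (h : IsAngleParam Γ R M) (hw : ∀ α, width γ α = breadth Γ α)
    {φ₀ φ₁ φ₂ φ₃ e₀ d₁ e₁ d₂ e₂ d₃ : {A // A ∉ table Γ} → ℝ} {B A' : {A // A ∉ table Γ} → ℂ}
    (hp : ∀ a, TangentPair Γ (φ₀ a) (φ₁ a) a (e₀ a) (d₁ a))
    (hq : ∀ a, TangentPair Γ (φ₁ a) (φ₂ a) (B a) (e₁ a) (d₂ a))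
    (hr : ∀ a, TangentPair Γ (φ₂ a) (φ₃ a) (A' a) (e₂ a) (d₃ a))
    (hs : ∀ a, SameCircle (φ₀ a) (φ₁ a) (φ₂ a) (d₁ a) (e₁ a))
    (hs' : ∀ a, SameCircle (φ₁ a) (φ₂ a) (φ₃ a) (d₂ a) (e₂ a)) :
    ∃ C : ℝ, ∀ O ∈ table Γ, ∀ a : {A // A ∉ table Γ},
      ‖A' a - timeOneFlow γ O a‖ ≤ C / ‖(a : ℂ) - O‖ := by
  have hM := h.bound_pos
  have hπ := Real.pi_pos
  set L := 2 * Real.pi * M with hL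
  have hL0 : 0 < L := by positivity
  obtain ⟨C₀, hC₀, hO₀⟩ :=
    (isBigO_two_steps (l := comap d₁ atTop) h hp hq hr hs hs' tendsto_comap).exists_pos
  have hbound := hO₀.bound
  rw [eventually_comap] at hbound
  obtain ⟨D, hD⟩ := eventually_atTop.1 hbound
  set Q := |D| + 2 * L with hQ
  have hQ0 : 0 ≤ Q := by positivity
  obtain ⟨E₁, hE₁⟩ := SameCircle.exists_le h (Q + L)
  obtain ⟨E₂, hE₂⟩ := SameCircle.exists_le h (E₁ + L)
  set C₁ := 2 * C₀ + 8 * Real.pi * M * (2 * L) + 8 * Real.pi * M * (4 * Real.pi * M)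
  set C₂ := (2 * Q + (Q + L) + E₁ + (E₁ + L) + E₂) * Q
  refine ⟨max C₁ C₂, fun O hO a => ?_⟩
  have hne : (a : ℂ) ≠ O := fun he => a.2 (he ▸ hO)
  have hpos : 0 < ‖(a : ℂ) - O‖ := norm_pos_iff.2 (sub_ne_zero.2 hne)
  have hOφ := h.norm_sub_le_of_mem_table hO (φ₁ a)
  have hd := (hp a).norm_sub_right h
  have hsub : |‖(a : ℂ) - O‖ - d₁ a| ≤ L := by
    rw [← hd]
    refine (abs_norm_sub_norm_le _ _).trans ?_
    rwa [sub_sub_sub_cancel_left, norm_sub_rev]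
  have hsub1 := (abs_le.1 hsub).1
  have hsub2 := (abs_le.1 hsub).2
  rw [le_div_iff₀ hpos]
  rcases le_total Q ‖(a : ℂ) - O‖ with hfar | hnear
  · refine le_trans ?_ (le_max_left _ _)
    have hd₁ : D ≤ d₁ a := by linarith [le_abs_self D]
    have h1 := hD _ hd₁ a rfl
    have hd₁' : ‖(a : ℂ) - O‖ ≤ 2 * d₁ a := by linarith [abs_nonneg D]
    have hd₁0 := (hp a).right_pos h
    rw [Real.norm_of_nonneg (inv_nonneg.2 hd₁0.le), ← div_eq_mul_inv, le_div_iff₀ hd₁0] at h1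
    have h2 := h.norm_timeOneFlow_sub_le hw hne
    rw [le_div_iff₀ hpos] at h2
    have h3 := h.norm_fieldDir_sub_le (φ₁ a + Real.pi) ((a : ℂ) - O).arg
    have h4 := mul_norm_dir_sub_le (A := a) (O := O) (P := Γ (φ₁ a)) (φ := φ₁ a + Real.pi)
      hd₁0.le (by rw [dir_add_pi]; linear_combination (hp a).eq_right)
    set q := ‖(a : ℂ) - O‖
    set u := A' a - a - fieldDir Γ (φ₁ a + Real.pi)
    set v := fieldDir Γ (φ₁ a + Real.pi) - fieldDir Γ ((a : ℂ) - O).arg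
    set w := timeOneFlow γ O a - a - fieldDir Γ ((a : ℂ) - O).arg
    have e : A' a - timeOneFlow γ O a = u + v - w := by simp only [u, v, w]; ring
    have h5 : ‖A' a - timeOneFlow γ O a‖ ≤ ‖u‖ + ‖v‖ + ‖w‖ := by
      rw [e]
      exact (_root_.norm_sub_le _ _).trans (add_le_add_left (norm_add_le _ _) _)
    have h6 : ‖u‖ * q ≤ 2 * C₀ := by nlinarith [norm_nonneg u]
    have h7 : ‖v‖ * q ≤ 8 * Real.pi * M * (2 * L) := by
      calc ‖v‖ * q ≤ 8 * Real.pi * M * ‖dir (φ₁ a + Real.pi) - dir ((a : ℂ) - O).arg‖ * q := by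
            gcongr
        _ = 8 * Real.pi * M * (q * ‖dir (φ₁ a + Real.pi) - dir ((a : ℂ) - O).arg‖) := by ring
        _ ≤ 8 * Real.pi * M * (2 * L) := by
            refine mul_le_mul_of_nonneg_left ?_ (by positivity)
            linarith
    calc _ ≤ (‖u‖ + ‖v‖ + ‖w‖) * q := mul_le_mul_of_nonneg_right h5 hpos.le
      _ ≤ _ := by simp only [C₁]; linarith
  · refine le_trans ?_ (le_max_right _ _)
    have k1 : d₁ a ≤ Q + L := by linarith
    have k2 := hE₁ _ _ _ _ _ _ _ _ _ (hp a) (hq a) (hs a) k1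
    have k3 : d₂ a ≤ E₁ + L := by
      have := (abs_le.1 ((hq a).abs_left_sub_right_le h)).1
      linarith
    have k4 := hE₂ _ _ _ _ _ _ _ _ _ (hq a) (hr a) (hs' a) k3
    have e : A' a - timeOneFlow γ O a = (A' a - Γ (φ₂ a)) - (B a - Γ (φ₂ a)) + (B a - Γ (φ₁ a))
        - ((a : ℂ) - Γ (φ₁ a)) + ((a : ℂ) - O) - (timeOneFlow γ O a - O) := by ring
    have k5 : ‖A' a - timeOneFlow γ O a‖
        ≤ e₂ a + d₂ a + e₁ a + d₁ a + ‖(a : ℂ) - O‖ + ‖(a : ℂ) - O‖ := by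
      rw [e]
      have n1 := _root_.norm_sub_le (A' a - Γ (φ₂ a) - (B a - Γ (φ₂ a)) + (B a - Γ (φ₁ a))
        - ((a : ℂ) - Γ (φ₁ a)) + ((a : ℂ) - O)) (timeOneFlow γ O a - O)
      have n2 := norm_add_le (A' a - Γ (φ₂ a) - (B a - Γ (φ₂ a)) + (B a - Γ (φ₁ a))
        - ((a : ℂ) - Γ (φ₁ a))) ((a : ℂ) - O)
      have n3 := _root_.norm_sub_le (A' a - Γ (φ₂ a) - (B a - Γ (φ₂ a)) + (B a - Γ (φ₁ a)))
        ((a : ℂ) - Γ (φ₁ a))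
      have n4 := norm_add_le (A' a - Γ (φ₂ a) - (B a - Γ (φ₂ a))) (B a - Γ (φ₁ a))
      have n5 := _root_.norm_sub_le (A' a - Γ (φ₂ a)) (B a - Γ (φ₂ a))
      rw [(hr a).norm_sub_left h, (hq a).norm_sub_right h] at n5
      rw [(hq a).norm_sub_left h] at n4
      rw [hd] at n3
      rw [h.norm_timeOneFlow_sub_center hw hne] at n1
      linarith
    have k6 : ‖A' a - timeOneFlow γ O a‖ ≤ 2 * Q + (Q + L) + E₁ + (E₁ + L) + E₂ := by linarith
    exact mul_le_mul k6 hnear hpos.le ((norm_nonneg _).trans k6)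

end OuterLength

/-- The first two conjuncts say that the outer length billiard map is a well-defined map of the exterior of
the oval to itself and that the time-1 flow is well defined; the third one is the estimate. -/
theorem theorem4p1 (γ : ℝ → ℂ) (T : ℝ) (hγ : OuterLength.IsOval γ T) :
    (∀ A ∉ OuterLength.table γ, OuterLength.billiardMap γ A ∉ OuterLength.table γ ∧
      ∀ B, OuterLength.IsImage γ A B ↔ B = OuterLength.billiardMap γ A) ∧
    (∀ O : ℂ, ∀ p ≠ O, ∀ q,
      OuterLength.IsTimeOneFlow γ O p q ↔ q = OuterLength.timeOneFlow γ O p) ∧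
    ∃ C : ℝ, ∀ O ∈ interior (OuterLength.table γ), ∀ A ∉ OuterLength.table γ,
      ‖OuterLength.billiardMap γ (OuterLength.billiardMap γ A) - OuterLength.timeOneFlow γ O A‖ ≤
        C / ‖A - O‖ := by
  open OuterLength in
  obtain ⟨Γ, R, M, θ, h, hθ, hγΓ, hγ'⟩ := hγ.exists_isAngleParam
  have hrange : Set.range γ = Set.range Γ := by
    rw [show γ = Γ ∘ θ from funext hγΓ, hθ.range_comp]
  have htable : table γ = table Γ := by rw [table, hrange, table]
  have hw := h.width_eq hrange
  -- a point with given angles has exactly one image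
  have himage {φ₀ φ₁ φ₂ e₀ d₁ e₁ d₂ : ℝ} {A B : ℂ} (p : TangentPair Γ φ₀ φ₁ A e₀ d₁)
      (q : TangentPair Γ φ₁ φ₂ B e₁ d₂) (hs : SameCircle φ₀ φ₁ φ₂ d₁ e₁) :
      billiardMap γ A = B ∧ ∀ B', IsImage γ A B' ↔ B' = billiardMap γ A := by
    have hB : IsImage γ A B := (isImage_iff hγ h hθ hγΓ hγ' p B).2 ⟨φ₂, e₁, d₂, q, hs⟩
    have huniq (B' : ℂ) (hB' : IsImage γ A B') : B' = B := by
      obtain ⟨φ₂', e₁', d₂', q', hs'⟩ := (isImage_iff hγ h hθ hγΓ hγ' p B').1 hB'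
      exact h.eq_of_sameCircle p q' q hs' hs
    have hspec : IsImage γ A (billiardMap γ A) := Classical.epsilon_spec ⟨B, hB⟩
    exact ⟨huniq _ hspec, fun B' => ⟨fun hB' => (huniq _ hB').trans (huniq _ hspec).symm,
      fun hB' => hB' ▸ hspec⟩⟩
  rw [htable]
  choose φ₀ φ₁ e₀ d₁ hp using fun A : {A // A ∉ table Γ} => h.exists_tangentPair A.2
  choose φ₂ B e₁ d₂ hq hs using fun A => h.exists_sameCircle (hp A)
  choose φ₃ A' e₂ d₃ hr hs' using fun A => h.exists_sameCircle (hq A)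
  refine ⟨fun A hA => ?_, fun O p hpO q => h.isTimeOneFlow_iff hw hpO q, ?_⟩
  · obtain ⟨hB, hiff⟩ := himage (hp ⟨A, hA⟩) (hq ⟨A, hA⟩) (hs ⟨A, hA⟩)
    exact ⟨hB ▸ (hq ⟨A, hA⟩).notMem_table h, hiff⟩
  · obtain ⟨C, hC⟩ := h.exists_norm_sub_timeOneFlow_le hw hp hq hr hs hs'
    refine ⟨C, fun O hO A hA => ?_⟩
    have h1 : billiardMap γ A = B ⟨A, hA⟩ := (himage (hp ⟨A, hA⟩) (hq _) (hs _)).1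
    rw [h1, (himage (hq ⟨A, hA⟩) (hr _) (hs' _)).1]
    exact hC O (interior_subset hO) ⟨A, hA⟩
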